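/- Let $q>2$ be a prime power, let $n\ge 3$, and let $\mathbb F_q$ be the field with $q$ elements. A line in $\mathbb F_q^n$ is a coset $U+x$ of a one-dimensional subspace $U$ of $\mathbb F_q^n$. For a permutation $f$ of $\mathbb F_q^n$, let $1\text{-coaffinity}(f)$ be the number of lines $L$ in $\mathbb F_q^n$ such that $f(L)$ is not a line. Let $\mathrm{A\Gamma L}(n,\mathbb F_q)$ be the group of all invertible semi-affine transformations of $\mathbb F_q^n$, that is, of all maps $x\mapsto g(x)+b$ where $b\in\mathbb F_q^n$ and $g$ is an additive automorphism of $\mathbb F_q^n$ for which there is a field automorphism $\sigma$ of $\mathbb F_q$ with $g(\alpha x)=\sigma(\alpha)g(x)$ for all $\alpha\in\mathbb F_q$ and $x\in\mathbb F_q^n$. Let $f$ be a permutation of $\mathbb F_q^n$ that does not belong to $\mathrm{A\Gamma L}(n,\mathbb F_q)$. Then $$1\text{-coaffinity}(f)\ \ge\ \frac{2q\,(q^{n-1}-1)}{q-1}.$$ Moreover, for any transposition $\tau$ of $\mathbb F_q^n$ (a permutation that interchanges two distinct points and fixes all others), equality holds if and only if $f\in \mathrm{A\Gamma L}(n,\mathbb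 F_q)\circ\tau\circ\mathrm{A\Gamma L}(n,\mathbb F_q)$. -/

import Mathlib

/-- `X` is a `k`-flat of the `F`-vector space `V`: a coset `U + x` of a `k`-dimensional
subspace `U`. -/
def IsFlat (F : Type*) {V : Type*} [Field F] [AddCommGroup V] [Module F V]
    (k : ℕ) (X : Set V) : Prop :=
  ∃ (U : Submodule F V) (x : V), Module.finrank F U = k ∧ X = {y | ∃ u ∈ U, y = u + x}

/-- The number of `k`-flats `X` such that `f(X)` is not a `k`-flat. It is used for finite `V`
only, where every set of subsets is finite. -/
noncomputable def coaffinity (F : Type*) {V : Type*} [Field F] [AddCommGroup V] [Module F V]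
    (k : ℕ) (f : Equiv.Perm V) : ℕ :=
  Set.ncard {X : Set V | IsFlat F k X ∧ ¬ IsFlat F k (f '' X)}

/-- `f` is an invertible semi-affine transformation: `f(x) = g(x) + b` with `g` an additive
automorphism that is semilinear over a field automorphism `σ`. -/
def IsSemiAffine (F : Type*) {V : Type*} [Field F] [AddCommGroup V] [Module F V]
    (f : Equiv.Perm V) : Prop :=
  ∃ (σ : F ≃+* F) (g : V ≃+ V) (b : V),
    (∀ (α : F) (x : V), g (α • x) = σ α • g x) ∧ ∀ x : V, f x = g x + b

/-- The group `AΓL(n, F)` of all invertible semi-affine transformations of `F ^ n`. -/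
def AGammaL (n : ℕ) (F : Type*) [Field F] : Subgroup (Equiv.Perm (Fin n → F)) where
  carrier := {f | IsSemiAffine F f}
  one_mem' := ⟨RingEquiv.refl F, AddEquiv.refl _, 0, by simp, by simp⟩
  mul_mem' := by
    rintro f₁ f₂ ⟨σ₁, g₁, b₁, h₁, e₁⟩ ⟨σ₂, g₂, b₂, h₂, e₂⟩
    refine ⟨σ₂.trans σ₁, g₂.trans g₁, g₁ b₂ + b₁, fun α x => ?_, fun x => ?_⟩
    · simp [h₁, h₂]
    · simp [e₁, e₂, add_assoc]
  inv_mem' := by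
    rintro f ⟨σ, g, b, h, e⟩
    refine ⟨σ.symm, g.symm, -g.symm b, fun α x => ?_, fun x => ?_⟩
    · apply g.injective
      simp [h]
    · rw [Equiv.Perm.inv_eq_iff_eq, e]
      simp

/-! The bound equals `2 (q^n - q) / (q - 1)`, the number of lines through exactly one of two given
points, which is what a transposition breaks. So everything reduces to `exists_eq_mul_swap`: if `f`
breaks at most that many lines and is not semiaffine, then `f` is a semiaffine map times a
transposition. The inequality follows because such an `f` attains the bound, the equality case
because all transpositions are conjugate under the 2-transitive affine group.

Broken lines are never isolated. If a plane had at most two of them, `f` would map it onto a plane,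
and a broken line would force two further broken lines in it; hence a plane with one broken line has
at least three (`exists_broken_in_plane`). Counting planes through a broken line inside a
hyperplane, a hyperplane with one broken line has many (`card_brokenIn_ge`). Counting incidences of
hyperplanes and broken lines, the assumed bound leaves two nonparallel hyperplanes without broken
lines (`exists_clean_hyperplane`).

On each of these the fundamental theorem of affine geometry applies, and the two semiaffine maps
glue to one `G` (`exists_semiAffine_of_clean`). Then `h = G⁻¹ f` fixes both hyperplanes pointwise. A
point moved by `h` breaks most lines that join it to two fixed points in the hyperplanes, so few
points move (`card_movedPoints_le_of_fixed`). When few points move, most lines through a moved point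
contain no other moved point, and these are all broken (`card_movedPoints_mul_le`). The two
estimates together exclude three or more moved points. -/

/-! ### Lines in a vector space -/

section Lines

variable {F V : Type*} [Field F] [AddCommGroup V] [Module F V]

/-- The line through `a` with direction `d`. -/
def lineAt (F : Type*) {V : Type*} [Field F] [AddCommGroup V] [Module F V] (a d : V) : Set V :=
  {y | ∃ t : F, y = a + t • d}

lemma self_mem_lineAt (a d : V) : a ∈ lineAt F a d := ⟨0, by simp⟩

lemma add_mem_lineAt (a d : V) : a + d ∈ lineAt F a d := ⟨1, by simp⟩

lemma right_mem_lineAt (x y : V) : y ∈ lineAt F x (y - x) := ⟨1, by simp⟩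

lemma isFlat_one_iff {X : Set V} :
    IsFlat F 1 X ↔ ∃ a d : V, d ≠ 0 ∧ X = lineAt F a d := by
  constructor
  · rintro ⟨U, x, hU, rfl⟩
    obtain ⟨⟨v, hvU⟩, hv, h⟩ := finrank_eq_one_iff'.1 hU
    refine ⟨x, v, fun h0 => hv (by ext; simpa using h0), ?_⟩
    ext y
    constructor
    · rintro ⟨u, hu, rfl⟩
      obtain ⟨c, hc⟩ := h ⟨u, hu⟩
      exact ⟨c, by rw [add_comm]; congr 1; exact (congrArg Subtype.val hc).symm⟩
    · rintro ⟨t, rfl⟩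
      exact ⟨t • v, U.smul_mem _ hvU, add_comm _ _⟩
  · rintro ⟨a, d, hd, rfl⟩
    refine ⟨Submodule.span F {d}, a, finrank_span_singleton hd, ?_⟩
    ext y
    constructor
    · rintro ⟨t, rfl⟩
      exact ⟨t • d, Submodule.smul_mem _ _ (Submodule.mem_span_singleton_self d), add_comm _ _⟩
    · rintro ⟨u, hu, rfl⟩
      obtain ⟨t, rfl⟩ := Submodule.mem_span_singleton.1 hu
      exact ⟨t, add_comm _ _⟩

lemma isFlat_lineAt (a : V) {d : V} (hd : d ≠ 0) : IsFlat F 1 (lineAt F a d) :=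
  isFlat_one_iff.2 ⟨a, d, hd, rfl⟩

lemma isFlat_join {x y : V} (h : x ≠ y) : IsFlat F 1 (lineAt F x (y - x)) :=
  isFlat_lineAt x (sub_ne_zero.2 h.symm)

lemma lineAt_eq_of_mem {a d x y : V} (hx : x ∈ lineAt F a d) (hy : y ∈ lineAt F a d)
    (hxy : x ≠ y) : lineAt F a d = lineAt F x (y - x) := by
  obtain ⟨s, rfl⟩ := hx
  obtain ⟨t, rfl⟩ := hy
  have hst : t - s ≠ 0 := by
    intro h
    rw [sub_eq_zero] at h
    exact hxy (by rw [h])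
  have e : a + t • d - (a + s • d) = (t - s) • d := by module
  rw [e]
  ext z
  constructor
  · rintro ⟨r, rfl⟩
    refine ⟨(r - s) / (t - s), ?_⟩
    rw [smul_smul, div_mul_cancel₀ _ hst]
    module
  · rintro ⟨r, rfl⟩
    exact ⟨s + r * (t - s), by module⟩

lemma IsFlat.eq_lineAt {X : Set V} (hX : IsFlat F 1 X) {x y : V} (hx : x ∈ X) (hy : y ∈ X)
    (hxy : x ≠ y) : X = lineAt F x (y - x) := by
  obtain ⟨a, d, hd, rfl⟩ := isFlat_one_iff.1 hX
  exact lineAt_eq_of_mem hx hy hxy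

lemma IsFlat.eq_of_mem {X Y : Set V} (hX : IsFlat F 1 X) (hY : IsFlat F 1 Y) {x y : V}
    (hxy : x ≠ y) (hx : x ∈ X) (hy : y ∈ X) (hx' : x ∈ Y) (hy' : y ∈ Y) : X = Y := by
  rw [hX.eq_lineAt hx hy hxy, hY.eq_lineAt hx' hy' hxy]

lemma IsFlat.exists_eq_lineAt {X : Set V} (hX : IsFlat F 1 X) {x : V} (hx : x ∈ X) :
    ∃ d : V, d ≠ 0 ∧ X = lineAt F x d := by
  obtain ⟨a, d, hd, rfl⟩ := isFlat_one_iff.1 hX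
  obtain ⟨s, rfl⟩ := hx
  refine ⟨d, hd, ?_⟩
  ext z
  constructor
  · rintro ⟨r, rfl⟩
    exact ⟨r - s, by module⟩
  · rintro ⟨r, rfl⟩
    exact ⟨s + r, by module⟩

lemma ncard_lineAt (a : V) {d : V} (hd : d ≠ 0) : (lineAt F a d).ncard = Nat.card F := by
  have : lineAt F a d = (fun t : F => a + t • d) '' Set.univ := by
    ext y
    simp [lineAt, eq_comm]
  rw [this, Set.ncard_image_of_injective, Set.ncard_univ]
  intro s t h
  exact smul_left_injective F hd (add_left_cancel h)

lemma IsFlat.ncard_eq {X : Set V} (hX : IsFlat F 1 X) : X.ncard = Nat.card F := by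
  obtain ⟨a, d, hd, rfl⟩ := isFlat_one_iff.1 hX
  exact ncard_lineAt a hd

omit [Field F] in
lemma exists_ne_ne_of_two_lt_card [Fintype F] (hq : 2 < Fintype.card F) (a b : F) :
    ∃ c, c ≠ a ∧ c ≠ b := by
  classical
  obtain ⟨c, hc⟩ := Finset.exists_mem_notMem_of_card_lt_card (s := {a, b}) (t := Finset.univ)
    (lt_of_le_of_lt Finset.card_le_two (by simpa using hq))
  exact ⟨c, by simpa using hc.2⟩

lemma IsFlat.exists_third [Fintype F] (hq : 2 < Fintype.card F) {X : Set V} (hX : IsFlat F 1 X)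
    (x y : V) : ∃ z ∈ X, z ≠ x ∧ z ≠ y := by
  by_contra! h
  have : X ⊆ {x, y} := fun z hz => by
    by_cases hzx : z = x
    · simp [hzx]
    · simp [h z hz hzx]
  have h1 := Set.ncard_le_ncard this (by simp)
  have h2 : ({x, y} : Set V).ncard ≤ 2 := (Set.ncard_insert_le _ _).trans (by simp)
  rw [hX.ncard_eq, Nat.card_eq_fintype_card] at h1
  omega

/-- A point of a plane is an average, with weights `s` and `1 - s`, of a point on each axis through
`a`. A weight other than 0 and 1 exists exactly when `q > 2`; this is where that hypothesis enters
the geometry. -/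
lemma line_through_axes {d₁ d₂ : V} {x y s : F} (hs : s ≠ 0) (hs1 : s ≠ 1) (a : V) :
    a + (x • d₁ + y • d₂) = a + (x / s) • d₁ +
      (1 - s) • (a + (y / (1 - s)) • d₂ - (a + (x / s) • d₁)) := by
  have h1 : (1 - s) ≠ 0 := sub_ne_zero.2 hs1.symm
  match_scalars <;> field_simp <;> ring

end Lines

/-! ### The fundamental theorem of affine geometry on a subspace -/

section FundamentalTheorem

variable {F V : Type*} [Field F] [AddCommGroup V] [Module F V]

lemma image_lineAt_of_isFlat {f : V → V} (hf : Function.Injective f) {a d : V} (hd : d ≠ 0)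
    (h : IsFlat F 1 (f '' lineAt F a d)) :
    f '' lineAt F a d = lineAt F (f a) (f (a + d) - f a) :=
  h.eq_lineAt (Set.mem_image_of_mem _ (self_mem_lineAt a d))
    (Set.mem_image_of_mem _ (add_mem_lineAt a d)) (fun h => hd (by simpa using hf h))

variable {U : Submodule F V} {f : V → V} (hf : Function.Injective f) (h0 : f 0 = 0)
  (hgood : ∀ a ∈ U, ∀ d ∈ U, d ≠ 0 → IsFlat F 1 (f '' lineAt F a d))

include hf h0 hgood

lemma image_lineAt_zero {x : V} (hx : x ∈ U) (hx0 : x ≠ 0) :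
    f '' lineAt F 0 x = lineAt F 0 (f x) := by
  have := image_lineAt_of_isFlat hf hx0 (hgood 0 U.zero_mem x hx hx0)
  simpa [h0] using this

lemma exists_map_smul {x : V} (hx : x ∈ U) (α : F) : ∃ β : F, f (α • x) = β • f x := by
  rcases eq_or_ne x 0 with rfl | hx0
  · exact ⟨0, by simp [h0]⟩
  · have : f (α • x) ∈ lineAt F 0 (f x) := by
      rw [← image_lineAt_zero hf h0 hgood hx hx0]
      exact Set.mem_image_of_mem _ ⟨α, by simp⟩
    obtain ⟨t, ht⟩ := this
    exact ⟨t, by simpa using ht⟩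

lemma exists_smul_eq_map {x : V} (hx : x ∈ U) (hx0 : x ≠ 0) (β : F) :
    ∃ α : F, f (α • x) = β • f x := by
  have : β • f x ∈ lineAt F 0 (f x) := ⟨β, by simp⟩
  rw [← image_lineAt_zero hf h0 hgood hx hx0] at this
  obtain ⟨_, ⟨α, rfl⟩, h⟩ := this
  exact ⟨α, by simpa using h⟩

lemma map_indep {x y : V} (hx : x ∈ U) (hx0 : x ≠ 0) (hxy : ∀ c : F, y ≠ c • x) (c : F) :
    f y ≠ c • f x := by
  intro h
  obtain ⟨α, hα⟩ := exists_smul_eq_map hf h0 hgood hx hx0 c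
  exact hxy α (hf (h.trans hα.symm))

omit hf h0 hgood in
lemma indep_symm {x y : V} (hx0 : x ≠ 0) (hxy : ∀ c : F, y ≠ c • x) (c : F) : x ≠ c • y := by
  rintro h
  have hc : c ≠ 0 := by
    rintro rfl
    exact hx0 (by simpa using h)
  exact hxy c⁻¹ (by rw [h, smul_smul, inv_mul_cancel₀ hc, one_smul])

omit hf h0 hgood in
lemma ne_zero_of_indep {x y : V} (hxy : ∀ c : F, y ≠ c • x) : y ≠ 0 :=
  fun h => hxy 0 (by simp [h])

/-- The point `x + y` lies on a line joining a multiple of `x` to a multiple of `y`, and `f` sends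
these to multiples of `f x` and `f y`. -/
lemma exists_map_add_eq_comb [Fintype F] (hq : 2 < Fintype.card F) {x y : V} (hx : x ∈ U)
    (hy : y ∈ U) (hxy : ∀ c : F, y ≠ c • x) :
    ∃ α β : F, f (x + y) = α • f x + β • f y := by
  obtain ⟨s, hs0, hs1⟩ := exists_ne_ne_of_two_lt_card hq (0 : F) 1
  have h1s : (1 - s) ≠ 0 := sub_ne_zero.2 hs1.symm
  have e := line_through_axes (d₁ := x) (d₂ := y) (x := 1) (y := 1) hs0 hs1 (0 : V)
  simp only [one_smul, zero_add] at e
  have hne : (1 / (1 - s)) • y - (1 / s) • x ≠ 0 := by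
    intro h
    rw [sub_eq_zero] at h
    refine hxy ((1 - s) * (1 / s)) ?_
    rw [mul_smul, ← h, smul_smul, mul_one_div_cancel h1s, one_smul]
  have hg := image_lineAt_of_isFlat hf hne (hgood _ (U.smul_mem (1 / s) hx) _
    (U.sub_mem (U.smul_mem (1 / (1 - s)) hy) (U.smul_mem (1 / s) hx)) hne)
  have hm : f (x + y) ∈ f '' lineAt F ((1 / s) • x) ((1 / (1 - s)) • y - (1 / s) • x) :=
    Set.mem_image_of_mem _ ⟨1 - s, e⟩
  rw [hg] at hm
  obtain ⟨t, ht⟩ := hm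
  obtain ⟨a, ha⟩ := exists_map_smul hf h0 hgood hx (1 / s)
  obtain ⟨b, hb⟩ := exists_map_smul hf h0 hgood hy (1 / (1 - s))
  rw [add_sub_cancel, ha, hb] at ht
  exact ⟨a - t * a, t * b, by rw [ht]; module⟩

/-- Parallelism forces the coefficient of `f x` to be 1: otherwise the image of the line `x + F y`
would meet the line `F (f y)`, which is the image of `F y`, although the two preimages are disjoint.
-/
lemma exists_map_add_eq [Fintype F] (hq : 2 < Fintype.card F) {x y : V} (hx : x ∈ U)
    (hy : y ∈ U) (hx0 : x ≠ 0) (hxy : ∀ c : F, y ≠ c • x) :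
    ∃ β : F, f (x + y) = f x + β • f y := by
  obtain ⟨α, β, h⟩ := exists_map_add_eq_comb hf h0 hgood hq hx hy hxy
  by_cases hα : α = 1
  · exact ⟨β, by rw [h, hα, one_smul]⟩
  exfalso
  have hα' : α - 1 ≠ 0 := sub_ne_zero.2 hα
  have hy0 := ne_zero_of_indep hxy
  have hg := image_lineAt_of_isFlat hf hy0 (hgood x hx y hy hy0)
  have hm : (-β / (α - 1)) • f y ∈ f '' lineAt F x y := by
    rw [hg]
    refine ⟨-1 / (α - 1), ?_⟩
    rw [h]
    match_scalars <;> field_simp <;> ring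
  obtain ⟨_, ⟨t, rfl⟩, ht⟩ := hm
  obtain ⟨c, hc⟩ := exists_smul_eq_map hf h0 hgood hy hy0 (-β / (α - 1))
  rw [← hc] at ht
  have := hf ht
  refine indep_symm hx0 hxy (c - t) ?_
  rw [sub_smul, ← this]
  simp

lemma map_add_of_indep [Fintype F] (hq : 2 < Fintype.card F) {x y : V} (hx : x ∈ U)
    (hy : y ∈ U) (hx0 : x ≠ 0) (hxy : ∀ c : F, y ≠ c • x) : f (x + y) = f x + f y := by
  obtain ⟨β, h⟩ := exists_map_add_eq hf h0 hgood hq hx hy hx0 hxy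
  obtain ⟨α, h'⟩ := exists_map_add_eq hf h0 hgood hq hy hx (ne_zero_of_indep hxy)
    (indep_symm hx0 hxy)
  rw [add_comm y x, h] at h'
  have hβ : β = 1 := by
    by_contra hβ
    have hβ' : β - 1 ≠ 0 := sub_ne_zero.2 hβ
    refine map_indep hf h0 hgood hx hx0 hxy ((α - 1) / (β - 1)) ?_
    have e : (β - 1) • f y = (α - 1) • f x := by
      rw [sub_smul, sub_smul, one_smul, one_smul, sub_eq_sub_iff_add_eq_add]
      rw [add_comm, h', add_comm]
    rw [div_eq_inv_mul, mul_smul, ← e, smul_smul, inv_mul_cancel₀ hβ', one_smul]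
  rw [h, hβ, one_smul]

/-- A line-preserving injection that fixes the origin is additive on a subspace of dimension at
least two. -/
lemma map_add_of_lines [Fintype F] (hq : 2 < Fintype.card F)
    (hU : ∀ x : V, ∃ z ∈ U, ∀ c : F, z ≠ c • x) {x y : V} (hx : x ∈ U) (hy : y ∈ U) :
    f (x + y) = f x + f y := by
  rcases eq_or_ne x 0 with rfl | hx0
  · simp [h0]
  by_cases hxy : ∀ c : F, y ≠ c • x
  · exact map_add_of_indep hf h0 hgood hq hx hy hx0 hxy
  push Not at hxy
  obtain ⟨c, rfl⟩ := hxy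
  -- For dependent vectors, `f (x + c • x + z)` is expanded in two ways with an auxiliary `z` off
  -- the line `F x`, so that only independent sums occur.
  obtain ⟨z, hz, hzx⟩ := hU x
  have key : ∀ a : F, f (a • x + z) = f (a • x) + f z := by
    intro a
    rcases eq_or_ne a 0 with rfl | ha
    · simp [h0]
    refine map_add_of_indep hf h0 hgood hq (U.smul_mem _ hx) hz (smul_ne_zero ha hx0) fun b => ?_
    rw [smul_smul]
    exact hzx _
  have e1 : f (x + c • x + z) = f (x + c • x) + f z := by
    have := key (1 + c)
    rwa [add_smul, one_smul] at this
  have e2 : f (x + (c • x + z)) = f x + f (c • x + z) := by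
    refine map_add_of_indep hf h0 hgood hq hx (U.add_mem hy hz) hx0 fun b hb => ?_
    refine hzx (b - c) ?_
    rw [sub_smul, ← hb]
    simp
  rw [key c, ← add_assoc, e1, ← add_assoc] at e2
  exact add_right_cancel e2

/-- A line-preserving injection that fixes the origin is semilinear on a subspace of dimension at
least two. -/
lemma exists_semilinear_of_lines [Fintype F] (hq : 2 < Fintype.card F)
    (hU : ∀ x : V, ∃ z ∈ U, ∀ c : F, z ≠ c • x) :
    ∃ σ : F ≃+* F, ∀ α : F, ∀ x ∈ U, f (α • x) = σ α • f x := by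
  have hadd := fun {x y : V} => map_add_of_lines hf h0 hgood hq hU (x := x) (y := y)
  have hne : ∀ {x : V}, x ≠ 0 → f x ≠ 0 := fun hx h => hx (hf (h.trans h0.symm))
  obtain ⟨e, he, hee⟩ := hU 0
  have he0 : e ≠ 0 := by simpa using hee 0
  choose σ hσ using fun α => exists_map_smul hf h0 hgood he α
  -- The factor by which `f` turns `α` into a scalar is the same at independent `x` and `y`: compare
  -- coefficients in `f (α • (x + y))`.
  have indep : ∀ x y, x ∈ U → y ∈ U → x ≠ 0 → (∀ c : F, y ≠ c • x) → ∀ α β : F,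
      f (α • x) = β • f x → f (α • y) = β • f y := by
    intro x y hx hy hx0 hxy α β h
    obtain ⟨γ, hγ⟩ := exists_map_smul hf h0 hgood hy α
    obtain ⟨δ, hδ⟩ := exists_map_smul hf h0 hgood (U.add_mem hx hy) α
    rw [smul_add, hadd (U.smul_mem _ hx) (U.smul_mem _ hy), hadd hx hy, h, hγ] at hδ
    have e1 : (γ - δ) • f y = (δ - β) • f x := by
      rw [sub_smul, sub_smul, sub_eq_sub_iff_add_eq_add, add_comm, hδ, smul_add]
    have hγδ : γ = δ := by
      by_contra hne'
      have h' : γ - δ ≠ 0 := sub_ne_zero.2 hne'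
      refine map_indep hf h0 hgood hx hx0 hxy ((δ - β) / (γ - δ)) ?_
      rw [div_eq_inv_mul, mul_smul, ← e1, smul_smul, inv_mul_cancel₀ h', one_smul]
    rw [hγδ, sub_self, zero_smul, eq_comm, smul_eq_zero, sub_eq_zero] at e1
    rw [hγ, hγδ, e1.resolve_right (hne hx0)]
  have all : ∀ α, ∀ x ∈ U, f (α • x) = σ α • f x := by
    intro α x hx
    rcases eq_or_ne x 0 with rfl | hx0
    · simp [h0]
    by_cases hxe : ∀ c : F, x ≠ c • e
    · exact indep e x he hx he0 hxe α _ (hσ α)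
    push Not at hxe
    obtain ⟨c, rfl⟩ := hxe
    -- A multiple of `e` is reached through a vector `z` independent of it.
    obtain ⟨z, hz, hze⟩ := hU e
    refine indep z _ hz hx (ne_zero_of_indep hze) (fun b hb => ?_) α _
      (indep e z he hz he0 hze α _ (hσ α))
    have hc : c ≠ 0 := by
      rintro rfl
      simp at hx0
    refine indep_symm he0 hze (c⁻¹ * b) ?_
    rw [mul_smul, ← hb, smul_smul, inv_mul_cancel₀ hc, one_smul]
  have cancel : ∀ {a b : F}, a • f e = b • f e → a = b := fun h =>
    smul_left_injective F (hne he0) h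
  let φ : F →+* F :=
    { toFun := σ
      map_one' := cancel (by rw [← all 1 e he, one_smul, one_smul])
      map_zero' := cancel (by rw [← all 0 e he, zero_smul, zero_smul, h0])
      map_mul' := fun a b => cancel (by
        rw [← all _ e he, mul_smul, all a _ (U.smul_mem _ he), all b e he, smul_smul])
      map_add' := fun a b => cancel (by
        rw [← all _ e he, add_smul, hadd (U.smul_mem _ he) (U.smul_mem _ he), all a e he,
          all b e he, add_smul]) }
  exact ⟨RingEquiv.ofBijective φ (Finite.injective_iff_bijective.1 φ.injective), all⟩

end FundamentalTheorem

/-! ### Broken lines in a plane -/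

section Planes

variable {F V : Type*} [Field F] [AddCommGroup V] [Module F V]

/-- The lines whose image under `f` is not a line. -/
def brokenLines (F : Type*) {V : Type*} [Field F] [AddCommGroup V] [Module F V] (f : V → V) :
    Set (Set V) :=
  {X | IsFlat F 1 X ∧ ¬ IsFlat F 1 (f '' X)}

/-- The plane through `a` spanned by the directions `d` and `e`. -/
def planeAt (F : Type*) {V : Type*} [Field F] [AddCommGroup V] [Module F V] (a d e : V) : Set V :=
  {p | ∃ x y : F, p = a + (x • d + y • e)}

lemma add_smul_mem_planeAt_left (a d e : V) (t : F) : a + t • d ∈ planeAt F a d e :=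
  ⟨t, 0, by simp⟩

lemma add_smul_mem_planeAt_right (a d e : V) (t : F) : a + t • e ∈ planeAt F a d e :=
  ⟨0, t, by simp⟩

lemma lineAt_subset_planeAt {a d e p u v : V} (hp : p ∈ planeAt F a d e) {x y : F}
    (hv : v = x • d + y • e) (hu : u = p) : lineAt F u v ⊆ planeAt F a d e := by
  subst hu hv
  obtain ⟨x', y', rfl⟩ := hp
  rintro _ ⟨t, rfl⟩
  exact ⟨x' + t * x, y' + t * y, by module⟩

lemma join_subset_planeAt {a d e u v : V} (hu : u ∈ planeAt F a d e)
    (hv : v ∈ planeAt F a d e) : lineAt F u (v - u) ⊆ planeAt F a d e := by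
  obtain ⟨x, y, rfl⟩ := hu
  obtain ⟨x', y', rfl⟩ := hv
  rintro _ ⟨t, rfl⟩
  exact ⟨x + t * (x' - x), y + t * (y' - y), by module⟩

lemma planeAt_eq_image (a d e : V) :
    planeAt F a d e = (fun p : F × F => a + (p.1 • d + p.2 • e)) '' Set.univ := by
  ext p
  simp [planeAt, eq_comm]

lemma ncard_planeAt_le [Finite F] (a d e : V) :
    (planeAt F a d e).ncard ≤ Nat.card F * Nat.card F := by
  rw [planeAt_eq_image, ← Nat.card_prod, ← Set.ncard_univ]
  exact Set.ncard_image_le Set.finite_univ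

lemma ncard_planeAt {a d e : V} (hd : d ≠ 0) (hde : ∀ c : F, e ≠ c • d) :
    (planeAt F a d e).ncard = Nat.card F * Nat.card F := by
  rw [planeAt_eq_image, ← Nat.card_prod, ← Set.ncard_univ, Set.ncard_image_of_injective]
  rintro ⟨x, y⟩ ⟨x', y'⟩ h
  have h1 : x • d + y • e = x' • d + y' • e := add_left_cancel h
  have hy : y = y' := by
    by_contra hy
    have hy' : y - y' ≠ 0 := sub_ne_zero.2 hy
    refine hde ((x' - x) / (y - y')) ?_
    have : (y - y') • e = (x' - x) • d := by
      rw [sub_smul, sub_smul, sub_eq_sub_iff_add_eq_add, add_comm, h1]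
    rw [div_eq_inv_mul, mul_smul, ← this, smul_smul, inv_mul_cancel₀ hy', one_smul]
  subst hy
  have hx : x = x' := smul_left_injective F hd (add_right_cancel h1)
  rw [hx]

lemma map_mem_of_isFlat_image {f : V → V} (hf : Function.Injective f) {X : Set V} {u v p : V}
    {A D E : V} (hX : IsFlat F 1 (f '' X)) (hu : u ∈ X) (hv : v ∈ X) (hp : p ∈ X) (huv : u ≠ v)
    (hfu : f u ∈ planeAt F A D E) (hfv : f v ∈ planeAt F A D E) : f p ∈ planeAt F A D E := by
  have h1 := hX.eq_lineAt (Set.mem_image_of_mem f hu) (Set.mem_image_of_mem f hv) (hf.ne huv)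
  exact join_subset_planeAt hfu hfv (h1 ▸ Set.mem_image_of_mem f hp)

/-- An injection that maps sufficiently many lines of a plane to lines maps the plane into a
plane. -/
lemma map_mem_planeAt [Fintype F] (hq : 2 < Fintype.card F) {f : V → V}
    (hf : Function.Injective f) {a d₁ d₂ : V} (h₁ : d₁ ≠ 0) (h₁₂ : ∀ c : F, d₂ ≠ c • d₁)
    {N : Set V}
    (hg₁ : ∀ p ∈ planeAt F a d₁ d₂, IsFlat F 1 (f '' lineAt F p d₁))
    (hg₂ : ∀ p ∈ planeAt F a d₁ d₂, IsFlat F 1 (f '' lineAt F p d₂))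
    (hg : ∀ X, IsFlat F 1 X → X ⊆ planeAt F a d₁ d₂ → a ∉ X → X ≠ N → IsFlat F 1 (f '' X))
    (hN : ∀ u ∈ N, ∀ t : F, t ≠ 0 → u + t • d₁ ∉ N) {p : V} (hp : p ∈ planeAt F a d₁ d₂) :
    f p ∈ planeAt F (f a) (f (a + d₁) - f a) (f (a + d₂) - f a) := by
  have h₂ : d₂ ≠ 0 := ne_zero_of_indep h₁₂
  have ha : a ∈ planeAt F a d₁ d₂ := ⟨0, 0, by simp⟩
  have axis₁ : ∀ x : F, f (a + x • d₁) ∈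
      planeAt F (f a) (f (a + d₁) - f a) (f (a + d₂) - f a) := by
    intro x
    have : f (a + x • d₁) ∈ f '' lineAt F a d₁ := Set.mem_image_of_mem f ⟨x, rfl⟩
    rw [image_lineAt_of_isFlat hf h₁ (hg₁ a ha)] at this
    obtain ⟨t, ht⟩ := this
    rw [ht]
    exact add_smul_mem_planeAt_left _ _ _ _
  have axis₂ : ∀ x : F, f (a + x • d₂) ∈
      planeAt F (f a) (f (a + d₁) - f a) (f (a + d₂) - f a) := by
    intro x
    have : f (a + x • d₂) ∈ f '' lineAt F a d₂ := Set.mem_image_of_mem f ⟨x, rfl⟩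
    rw [image_lineAt_of_isFlat hf h₂ (hg₂ a ha)] at this
    obtain ⟨t, ht⟩ := this
    rw [ht]
    exact add_smul_mem_planeAt_right _ _ _ _
  have gen : ∀ x y : F, a + (x • d₁ + y • d₂) ∉ N → f (a + (x • d₁ + y • d₂)) ∈
      planeAt F (f a) (f (a + d₁) - f a) (f (a + d₂) - f a) := by
    intro x y hxy
    rcases eq_or_ne x 0 with rfl | hx
    · simpa using axis₂ y
    rcases eq_or_ne y 0 with rfl | hy
    · simpa using axis₁ x
    -- Off the axes, the point is joined to both axes by a line that avoids `a`. That line is not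
    -- broken unless it is `N`, and the images of its two axis points already lie in the target
    -- plane.
    obtain ⟨s, hs0, hs1⟩ := exists_ne_ne_of_two_lt_card hq (0 : F) 1
    have h1s : (1 - s) ≠ 0 := sub_ne_zero.2 hs1.symm
    have haX : a ∉ lineAt F (a + (x / s) • d₁)
        (a + (y / (1 - s)) • d₂ - (a + (x / s) • d₁)) := by
      rintro ⟨t, ht⟩
      have h0 : ((1 - t) * (x / s)) • d₁ + (t * (y / (1 - s))) • d₂ = 0 := by
        have := sub_eq_zero.2 ht.symm
        rw [← this]
        module
      rcases eq_or_ne t 0 with rfl | ht0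
      · simp [hx, hs0, h₁] at h0
      · have hc : t * (y / (1 - s)) ≠ 0 := mul_ne_zero ht0 (div_ne_zero hy h1s)
        refine h₁₂ ((t * (y / (1 - s)))⁻¹ * -((1 - t) * (x / s))) ?_
        rw [mul_smul, neg_smul, ← eq_neg_of_add_eq_zero_right h0, smul_smul,
          inv_mul_cancel₀ hc, one_smul]
    have hne : a + (x / s) • d₁ ≠ a + (y / (1 - s)) • d₂ := by
      intro h
      refine h₁₂ ((y / (1 - s))⁻¹ * (x / s)) ?_
      rw [mul_smul, add_left_cancel h, smul_smul, inv_mul_cancel₀ (div_ne_zero hy h1s), one_smul]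
    have hpX : a + (x • d₁ + y • d₂) ∈ lineAt F (a + (x / s) • d₁)
        (a + (y / (1 - s)) • d₂ - (a + (x / s) • d₁)) := ⟨1 - s, line_through_axes hs0 hs1 a⟩
    refine map_mem_of_isFlat_image hf (hg _ (isFlat_join hne)
      (join_subset_planeAt (add_smul_mem_planeAt_left _ _ _ _)
        (add_smul_mem_planeAt_right _ _ _ _)) haX fun h => hxy (h ▸ hpX))
      (self_mem_lineAt _ _) (right_mem_lineAt _ _) hpX hne (axis₁ _) (axis₂ _)
  obtain ⟨x, y, rfl⟩ := hp
  by_cases hpN : a + (x • d₁ + y • d₂) ∈ N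
  · rcases eq_or_ne x 0 with rfl | hx
    · simpa using axis₂ y
    -- A point of `N` is reached along direction `d₁`, which is not that of `N`: that line contains
    -- a point of the second axis and a further point off `N`, both already treated.
    obtain ⟨x', hx0, hxx⟩ := exists_ne_ne_of_two_lt_card hq (0 : F) x
    have hN' : a + (x' • d₁ + y • d₂) ∉ N := by
      have := hN _ hpN (x' - x) (sub_ne_zero.2 hxx)
      rwa [show a + (x • d₁ + y • d₂) + (x' - x) • d₁ = a + (x' • d₁ + y • d₂) by module] at this
    refine map_mem_of_isFlat_image hf (hg₁ _ ⟨x, y, rfl⟩) (u := a + y • d₂)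
      (v := a + (x' • d₁ + y • d₂)) ⟨-x, by module⟩ ⟨x' - x, by module⟩
      (self_mem_lineAt _ _) ?_ (axis₂ y) (gen x' y hN')
    intro h
    have := add_left_cancel h
    rw [right_eq_add] at this
    exact (smul_ne_zero hx0 h₁) this
  · exact gen x y hpN

/-- If all broken lines in a plane belong to a set of at most two lines, one of them passing
through `a`, then the image of the plane is a plane. -/
lemma image_planeAt [Fintype F] (hq : 2 < Fintype.card F) {f : V → V}
    (hf : Function.Injective f) {a d e : V} (hd : d ≠ 0) (hde : ∀ c : F, e ≠ c • d)
    {N : Set V} (hN : IsFlat F 1 N)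
    (h : ∀ X, IsFlat F 1 X → X ⊆ planeAt F a d e → X ≠ lineAt F a d → X ≠ N →
      IsFlat F 1 (f '' X)) :
    ∃ D E : V, f '' planeAt F a d e = planeAt F (f a) D E := by
  -- The directions `e + c • d` are pairwise nonparallel and not parallel to `d`, and at most one is
  -- that of `N`. As `q ≥ 3`, two remain; lines in these directions are neither `lineAt F a d` nor
  -- `N`, so they serve as axes.
  have hNpar : ∃ c₀ : F, ∀ c, c ≠ c₀ → ∀ u ∈ N, ∀ t : F, t ≠ 0 → u + t • (e + c • d) ∉ N := by
    by_contra! hcon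
    obtain ⟨c, -, u, hu, t, ht, hut⟩ := hcon 0
    obtain ⟨c', hc', u', hu', t', ht', hut'⟩ := hcon c
    have hne : ∀ b : F, e + b • d ≠ 0 := fun b hb => hde (-b) (by
      rw [neg_smul]; exact eq_neg_of_add_eq_zero_left hb)
    obtain ⟨w, hw, rfl⟩ := hN.exists_eq_lineAt hu
    obtain ⟨s, hs⟩ := hut
    obtain ⟨r₁, hr₁⟩ := hu'
    obtain ⟨r₂, hr₂⟩ := hut'
    have e1 : t • (e + c • d) = s • w := add_left_cancel hs
    have e2 : t' • (e + c' • d) = (r₂ - r₁) • w := by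
      rw [hr₁] at hr₂
      have := sub_eq_zero.2 hr₂
      rw [← sub_eq_zero, ← this]
      module
    have hs0 : s ≠ 0 := by
      rintro rfl
      rw [zero_smul] at e1
      exact smul_ne_zero ht (hne c) e1
    have e3 : (s * t') • (e + c' • d) = ((r₂ - r₁) * t) • (e + c • d) := by
      rw [mul_smul, e2, mul_smul, e1, smul_comm]
    have e4 : (s * t' - (r₂ - r₁) * t) • e = ((r₂ - r₁) * t * c - s * t' * c') • d := by
      have := sub_eq_zero.2 e3
      rw [← sub_eq_zero, ← this]
      module
    by_cases hz : s * t' - (r₂ - r₁) * t = 0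
    · rw [hz, zero_smul, eq_comm, smul_eq_zero, or_iff_left hd, ← sub_eq_zero.1 hz, ← mul_sub] at e4
      rcases mul_eq_zero.1 e4 with h1 | h1
      · exact mul_ne_zero hs0 ht' h1
      · exact hc' (sub_eq_zero.1 h1).symm
    · refine hde ((s * t' - (r₂ - r₁) * t)⁻¹ * ((r₂ - r₁) * t * c - s * t' * c')) ?_
      rw [mul_smul, ← e4, smul_smul, inv_mul_cancel₀ hz, one_smul]
  obtain ⟨c₀, hc₀⟩ := hNpar
  obtain ⟨c₁, hc₁, -⟩ := exists_ne_ne_of_two_lt_card hq c₀ c₀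
  obtain ⟨c₂, hc₂, hc₂₁⟩ := exists_ne_ne_of_two_lt_card hq c₀ c₁
  have h21 : c₂ - c₁ ≠ 0 := sub_ne_zero.2 hc₂₁
  have hne : ∀ b : F, e + b • d ≠ 0 := fun b hb => hde (-b) (by
    rw [neg_smul]; exact eq_neg_of_add_eq_zero_left hb)
  have h₁₂ : ∀ c : F, e + c₂ • d ≠ c • (e + c₁ • d) := by
    intro c hc
    have e1 : (1 - c) • e = (c * c₁ - c₂) • d := by
      have := sub_eq_zero.2 hc
      rw [← sub_eq_zero, ← this]
      module
    by_cases hz : 1 - c = 0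
    · rw [hz, zero_smul, eq_comm, smul_eq_zero, or_iff_left hd, ← sub_eq_zero.1 hz, one_mul] at e1
      exact hc₂₁ (sub_eq_zero.1 e1).symm
    · refine hde ((1 - c)⁻¹ * (c * c₁ - c₂)) ?_
      rw [mul_smul, ← e1, smul_smul, inv_mul_cancel₀ hz, one_smul]
  have hdd : d = (c₂ - c₁)⁻¹ • (e + c₂ • d - (e + c₁ • d)) := by
    rw [add_sub_add_left_eq_sub, ← sub_smul, smul_smul, inv_mul_cancel₀ h21, one_smul]
  have hplane : planeAt F a d e = planeAt F a (e + c₁ • d) (e + c₂ • d) := by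
    ext p
    constructor
    · rintro ⟨x, y, rfl⟩
      refine ⟨(y * c₂ - x) / (c₂ - c₁), (x - y * c₁) / (c₂ - c₁), ?_⟩
      match_scalars <;> field_simp <;> ring
    · rintro ⟨x, y, rfl⟩
      exact ⟨x * c₁ + y * c₂, x + y, by module⟩
  have hdir : ∀ c, c ≠ c₀ → ∀ p ∈ planeAt F a d e, IsFlat F 1 (f '' lineAt F p (e + c • d)) := by
    intro c hc p hp
    refine h _ (isFlat_lineAt _ (hne c)) (lineAt_subset_planeAt (x := c) (y := 1) hp ?_ rfl) ?_ ?_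
    · rw [one_smul, add_comm]
    · intro hL
      have h1 : p ∈ lineAt F a d := hL ▸ self_mem_lineAt _ _
      have h2 : p + (e + c • d) ∈ lineAt F a d := hL ▸ add_mem_lineAt _ _
      obtain ⟨s, rfl⟩ := h1
      obtain ⟨r, hr⟩ := h2
      refine hde (r - s - c) ?_
      have := sub_eq_zero.2 hr
      rw [← sub_eq_zero, ← this]
      module
    · intro hL
      have h1 : p ∈ N := hL ▸ self_mem_lineAt _ _
      have h2 : p + (e + c • d) ∈ N := hL ▸ add_mem_lineAt _ _
      exact hc₀ c hc p h1 1 one_ne_zero (by rwa [one_smul])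
  have hsub : ∀ p ∈ planeAt F a d e, f p ∈ planeAt F (f a)
      (f (a + (e + c₁ • d)) - f a) (f (a + (e + c₂ • d)) - f a) := by
    rw [hplane] at h hdir ⊢
    refine fun p hp => map_mem_planeAt hq hf (hne c₁) h₁₂ (N := N) (hdir c₁ hc₁) (hdir c₂ hc₂) ?_
      (hc₀ c₁ hc₁) hp
    intro X hX hXs haX hXN
    exact h X hX hXs (fun hL => haX (hL ▸ self_mem_lineAt _ _)) hXN
  -- The image has `q²` points and the target at most `q²`, so independence of the new directions
  -- need not be checked.
  refine ⟨_, _, Set.eq_of_subset_of_ncard_le (Set.image_subset_iff.2 hsub) ?_ ?_⟩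
  · rw [Set.ncard_image_of_injective _ hf, ncard_planeAt hd hde]
    exact ncard_planeAt_le _ _ _
  · rw [planeAt_eq_image]
    exact Set.toFinite _

/-- A plane that contains a broken line contains at least three broken lines. -/
lemma exists_broken_in_plane [Fintype F] (hq : 2 < Fintype.card F) {f : V → V}
    (hf : Function.Injective f) {a d e : V} (hd : d ≠ 0) (hde : ∀ c : F, e ≠ c • d)
    (hL : ¬ IsFlat F 1 (f '' lineAt F a d)) :
    ∃ N₁ ∈ brokenLines F f, ∃ N₂ ∈ brokenLines F f, N₁ ⊆ planeAt F a d e ∧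
      N₂ ⊆ planeAt F a d e ∧ N₁ ≠ lineAt F a d ∧ N₂ ≠ lineAt F a d ∧ N₁ ≠ N₂ := by
  by_contra hcon
  have huniq : ∀ N₁ N₂, IsFlat F 1 N₁ → IsFlat F 1 N₂ → ¬ IsFlat F 1 (f '' N₁) →
      ¬ IsFlat F 1 (f '' N₂) → N₁ ⊆ planeAt F a d e → N₂ ⊆ planeAt F a d e →
      N₁ ≠ lineAt F a d → N₂ ≠ lineAt F a d → N₁ = N₂ := by
    intro N₁ N₂ h1 h2 h3 h4 h5 h6 h7 h8
    by_contra h9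
    exact hcon ⟨N₁, ⟨h1, h3⟩, N₂, ⟨h2, h4⟩, h5, h6, h7, h8, h9⟩
  have hN : ∃ N, IsFlat F 1 N ∧ ∀ X, IsFlat F 1 X → X ⊆ planeAt F a d e → X ≠ lineAt F a d →
      X ≠ N → IsFlat F 1 (f '' X) := by
    by_cases hex : ∃ N, IsFlat F 1 N ∧ ¬ IsFlat F 1 (f '' N) ∧ N ⊆ planeAt F a d e ∧
      N ≠ lineAt F a d
    · obtain ⟨N, h1, h2, h3, h4⟩ := hex
      refine ⟨N, h1, fun X hX hXs hXL hXN => ?_⟩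
      by_contra hb
      exact hXN (huniq X N hX h1 hb h2 hXs h3 hXL h4)
    · refine ⟨lineAt F a d, isFlat_lineAt a hd, fun X hX hXs hXL _ => ?_⟩
      by_contra hb
      exact hex ⟨X, hX, hb, hXs, hXL⟩
  obtain ⟨N, hNf, hN⟩ := hN
  obtain ⟨D, E, hE⟩ := image_planeAt hq hf hd hde hNf hN
  have hne : a ≠ a + d := fun h => hd (by simpa using h)
  have hLs : lineAt F a d ⊆ planeAt F a d e := by
    rintro _ ⟨t, rfl⟩
    exact add_smul_mem_planeAt_left _ _ _ _
  have haL : a ∈ lineAt F a d := self_mem_lineAt a d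
  have hbL : a + d ∈ lineAt F a d := add_mem_lineAt a d
  have hK := isFlat_join (F := F) (hf.ne hne)
  have hKs : lineAt F (f a) (f (a + d) - f a) ⊆ f '' planeAt F a d e := by
    rw [hE]
    apply join_subset_planeAt <;> rw [← hE]
    exacts [Set.mem_image_of_mem f (hLs haL), Set.mem_image_of_mem f (hLs hbL)]
  have hfin : (f '' lineAt F a d).Finite := by
    refine Set.Finite.image _ (Set.finite_of_ncard_ne_zero ?_)
    rw [ncard_lineAt a hd, Nat.card_eq_fintype_card]
    omega
  -- Let `K` be the line through `f a` and `f (a + d)`. It lies in the image plane and differs from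
  -- the image of the broken line, which has the same size. So `K` contains some `f u` with `u` off
  -- the broken line.
  have hKL : ¬ lineAt F (f a) (f (a + d) - f a) ⊆ f '' lineAt F a d := by
    intro hsub
    have := Set.eq_of_subset_of_ncard_le hsub (by
      rw [Set.ncard_image_of_injective _ hf, ncard_lineAt a hd, hK.ncard_eq]) hfin
    exact hL (this ▸ hK)
  obtain ⟨k, hkK, hkL⟩ := Set.not_subset.1 hKL
  obtain ⟨u, hu, rfl⟩ := hKs hkK
  have huL : u ∉ lineAt F a d := fun h => hkL (Set.mem_image_of_mem f h)
  have hau : a ≠ u := fun h => huL (h ▸ haL)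
  have hbu : a + d ≠ u := fun h => huL (h ▸ hbL)
  -- If the line `x u` had a line as image, that image would be `K`; then `x u` would contain `y`
  -- and be the original line, which misses `u`. Hence the lines from `a` and from `a + d` to `u`
  -- are two more broken lines.
  have key : ∀ x y, x ∈ lineAt F a d → y ∈ lineAt F a d → x ≠ y → x ≠ u →
      f x ∈ lineAt F (f a) (f (a + d) - f a) → f y ∈ lineAt F (f a) (f (a + d) - f a) →
      ¬ IsFlat F 1 (f '' lineAt F x (u - x)) := by
    intro x y hx hy hxy hxu hfx hfy hgood
    have e1 := hgood.eq_of_mem hK (hf.ne hxu) (Set.mem_image_of_mem f (self_mem_lineAt _ _))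
      (Set.mem_image_of_mem f (right_mem_lineAt _ _)) hfx hkK
    have hy' : y ∈ lineAt F x (u - x) := by
      rw [← hf.mem_set_image, e1]
      exact hfy
    have := (isFlat_join (F := F) hxu).eq_of_mem (isFlat_lineAt a hd) hxy (self_mem_lineAt _ _) hy'
      hx hy
    exact huL (this ▸ right_mem_lineAt _ _)
  have e := huniq _ _ (isFlat_join hau) (isFlat_join hbu)
    (key a (a + d) haL hbL hne hau (self_mem_lineAt _ _) (right_mem_lineAt _ _))
    (key (a + d) a hbL haL hne.symm hbu (right_mem_lineAt _ _) (self_mem_lineAt _ _))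
    (join_subset_planeAt (hLs haL) hu) (join_subset_planeAt (hLs hbL) hu)
    (fun h => huL (h ▸ right_mem_lineAt _ _)) (fun h => huL (h ▸ right_mem_lineAt _ _))
  have := (isFlat_join (F := F) hau).eq_of_mem (isFlat_lineAt a hd) hne (self_mem_lineAt _ _)
    (e ▸ self_mem_lineAt _ _) haL hbL
  exact huL (this ▸ right_mem_lineAt _ _)

end Planes

/-! ### Hyperplanes without broken lines -/

section CleanHyperplanes

open Classical in
lemma card_fiber_mul {F W W' : Type*} [Field F] [AddCommGroup W] [Module F W] [AddCommGroup W']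
    [Module F W'] [Fintype W] [Fintype W'] {T : W →ₗ[F] W'} (hT : Function.Surjective T) (c : W') :
    (Finset.univ.filter fun w => T w = c).card * Fintype.card W' = Fintype.card W := by
  choose s hs using hT
  rw [← Fintype.card_subtype, ← Fintype.card_prod]
  refine Fintype.card_congr
    { toFun := fun p => p.1.1 + s (p.2 - c)
      invFun := fun w => (⟨w - s (T w - c), by simp [hs]⟩, T w)
      left_inv := ?_
      right_inv := fun w => by simp }
  rintro ⟨⟨w, hw⟩, t⟩
  simp [hs, hw]

open Classical in
lemma card_level_mul {F W : Type*} [Field F] [AddCommGroup W] [Module F W] [Fintype F] [Fintype W]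
    {φ : W →ₗ[F] F} (hφ : φ ≠ 0) (c : F) :
    (Finset.univ.filter fun w => φ w = c).card * Fintype.card F = Fintype.card W :=
  card_fiber_mul (LinearMap.surjective hφ) c

variable {F V : Type*} [Field F] [AddCommGroup V] [Module F V]

lemma planeAt_subset_level {φ : V →ₗ[F] F} {c : F} {a d e : V} (ha : φ a = c) (hd : φ d = 0)
    (he : φ e = 0) {p : V} (hp : p ∈ planeAt F a d e) : φ p = c := by
  obtain ⟨x, y, rfl⟩ := hp
  simp [ha, hd, he]

/-- The relation is symmetric: `z` lies in the plane of the line and `p` only if `p` lies in the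
plane of the line and `z`, which has `q (q - 1)` points off the line. -/
lemma card_planeAt_sdiff_le [Fintype F] [Fintype V] {a d z : V} (hz : z ∉ lineAt F a d)
    (s : Finset V)
    (hs : ∀ p ∈ s, p ∉ lineAt F a d ∧ z ∈ planeAt F a d (p - a)) :
    s.card ≤ Fintype.card F * (Fintype.card F - 1) := by
  classical
  have hsub : s ⊆ (Finset.univ ×ˢ Finset.univ.erase (0 : F)).image
      (fun p : F × F => a + (p.1 • d + p.2 • (z - a))) := by
    intro p hp
    obtain ⟨hpL, x, y, hxy⟩ := hs p hp
    have hy : y ≠ 0 := by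
      rintro rfl
      exact hz ⟨x, by simpa using hxy⟩
    refine Finset.mem_image.2 ⟨(-(y⁻¹ * x), y⁻¹), by simp [hy], ?_⟩
    simp only
    rw [hxy]
    match_scalars <;> field_simp <;> ring
  refine (Finset.card_le_card hsub).trans (Finset.card_image_le.trans ?_)
  rw [Finset.card_product, Finset.card_erase_of_mem (Finset.mem_univ _), Finset.card_univ]

open Classical in
/-- The broken lines contained in the hyperplane `φ = c`. -/
noncomputable def brokenIn [Fintype V] (f : V → V) (φ : V →ₗ[F] F) (c : F) : Finset (Set V) :=
  Finset.univ.filter fun X => X ∈ brokenLines F f ∧ ∀ x ∈ X, φ x = c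

lemma mem_brokenIn [Fintype V] {f : V → V} {φ : V →ₗ[F] F} {c : F} {X : Set V} :
    X ∈ brokenIn f φ c ↔ X ∈ brokenLines F f ∧ ∀ x ∈ X, φ x = c := by
  classical
  simp [brokenIn]

/-- A hyperplane that contains a broken line contains many of them. -/
lemma card_brokenIn_ge [Fintype F] [Fintype V] (hq : 2 < Fintype.card F) {f : V → V}
    (hf : Function.Injective f) {φ : V →ₗ[F] F} (hφ : φ ≠ 0) {c : F}
    (h : (brokenIn f φ c).Nonempty) :
    2 * Fintype.card V + Fintype.card F * (Fintype.card F * (Fintype.card F - 1)) ≤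
      Fintype.card F * ((brokenIn f φ c).card * (Fintype.card F * (Fintype.card F - 1))
        + 2 * Fintype.card F) := by
  classical
  obtain ⟨L, hLb⟩ := h
  obtain ⟨⟨hLf, hLbad⟩, hLφ⟩ := mem_brokenIn.1 hLb
  obtain ⟨a, d, hd, rfl⟩ := isFlat_one_iff.1 hLf
  have ha : φ a = c := hLφ a (self_mem_lineAt a d)
  have hφd : φ d = 0 := by
    have := hLφ _ (add_mem_lineAt a d)
    rwa [map_add, ha, add_eq_left] at this
  have hcardL : (lineAt F a d).toFinset.card = Fintype.card F := by
    rw [← Set.ncard_eq_toFinset_card', ncard_lineAt a hd, Nat.card_eq_fintype_card]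
  -- Points `p` of the hyperplane off the broken line are counted against the other broken lines `N`
  -- in the plane of that line and `p`: at least two `N` for each `p`, at most `q (q - 1)` points
  -- `p` for each `N`.
  have key := Finset.card_mul_le_card_mul (m := 2)
    (n := Fintype.card F * (Fintype.card F - 1)) (fun (p : V) (N : Set V) => N ⊆ planeAt F a d (p - a))
    (s := (Finset.univ.filter fun p => φ p = c) \ (lineAt F a d).toFinset)
    (t := (brokenIn f φ c).erase (lineAt F a d)) ?_ ?_
  · rw [Finset.card_erase_of_mem hLb] at key
    have h1 := Finset.le_card_sdiff (lineAt F a d).toFinset (Finset.univ.filter fun p => φ p = c)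
    rw [hcardL] at h1
    have h2 := card_level_mul hφ c
    have h3 : 0 < (brokenIn f φ c).card := Finset.card_pos.2 ⟨_, hLb⟩
    rw [← h2]
    generalize (Finset.univ.filter fun p => φ p = c).card = u at *
    generalize ((Finset.univ.filter fun p => φ p = c) \ (lineAt F a d).toFinset).card = s at *
    obtain ⟨b, hb⟩ := Nat.exists_eq_succ_of_ne_zero h3.ne'
    rw [hb] at key ⊢
    simp only [Nat.succ_sub_one] at key
    generalize Fintype.card F * (Fintype.card F - 1) = k at *
    have h4 : u ≤ s + Fintype.card F := by omega
    have : 2 * u + k ≤ b.succ * k + 2 * Fintype.card F := by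
      rw [Nat.succ_mul b k]
      omega
    calc _ = Fintype.card F * (2 * u + k) := by ring
      _ ≤ _ := Nat.mul_le_mul_left _ this
  · intro p hp
    simp only [Finset.mem_sdiff, Finset.mem_filter, Finset.mem_univ, true_and,
      Set.mem_toFinset] at hp
    have hpd : ∀ b : F, p - a ≠ b • d := fun b hb => hp.2 ⟨b, by rw [← hb]; abel⟩
    have hφp : φ (p - a) = 0 := by rw [map_sub, hp.1, ha, sub_self]
    obtain ⟨N₁, h1, N₂, h2, h3, h4, h5, h6, h7⟩ := exists_broken_in_plane hq hf hd hpd hLbad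
    refine Finset.one_lt_card.2 ⟨N₁, ?_, N₂, ?_, h7⟩
    · simp only [Finset.mem_bipartiteAbove, Finset.mem_erase, mem_brokenIn]
      exact ⟨⟨h5, h1, fun x hx => planeAt_subset_level ha hφd hφp (h3 hx)⟩, h3⟩
    · simp only [Finset.mem_bipartiteAbove, Finset.mem_erase, mem_brokenIn]
      exact ⟨⟨h6, h2, fun x hx => planeAt_subset_level ha hφd hφp (h4 hx)⟩, h4⟩
  · intro N hN
    simp only [Finset.mem_erase, mem_brokenIn] at hN
    obtain ⟨hNL, ⟨hNf, -⟩, -⟩ := hN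
    have : ¬ N ⊆ lineAt F a d := fun hsub => hNL <|
      Set.eq_of_subset_of_ncard_le hsub (by rw [hNf.ncard_eq, ncard_lineAt a hd]) (Set.toFinite _)
    obtain ⟨z, hzN, hz⟩ := Set.not_subset.1 this
    refine card_planeAt_sdiff_le hz _ fun p hp => ?_
    simp only [Finset.mem_bipartiteBelow, Finset.mem_sdiff, Set.mem_toFinset] at hp
    exact ⟨hp.1.2, hp.2 hzN⟩

/-- Few broken lines leave a hyperplane without broken lines, not parallel to a given one. -/
lemma exists_clean_hyperplane [Fintype F] [Fintype V] (hq : 2 < Fintype.card F)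
    (hV : Fintype.card F < Fintype.card V) {f : V → V} (hf : Function.Injective f)
    (hB : (Fintype.card F - 1) * (brokenLines F f).ncard + 2 * Fintype.card F
      ≤ 2 * Fintype.card V)
    (φ₀ : V →ₗ[F] F) :
    ∃ (φ : V →ₗ[F] F) (c : F), (∀ b : F, φ ≠ b • φ₀) ∧
      ∀ X, IsFlat F 1 X → (∀ x ∈ X, φ x = c) → IsFlat F 1 (f '' X) := by
  classical
  by_contra! hcon
  have : Module.Finite F V := Module.Finite.of_finite
  have : Finite (V →ₗ[F] F) := Finite.of_injective (fun φ => (φ : V → F)) DFunLike.coe_injective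
  have : Fintype (V →ₗ[F] F) := Fintype.ofFinite _
  have hdual : Fintype.card (V →ₗ[F] F) = Fintype.card V := by
    have e := Module.finBasis F V
    exact Fintype.card_congr (e.toDualEquiv).toEquiv.symm
  set B : Finset (Set V) := (Set.toFinite (brokenLines F f)).toFinset with hBdef
  have hBc : B.card = (brokenLines F f).ncard := (Set.ncard_eq_toFinset_card _ _).symm
  -- Hyperplanes are counted as equations `φ = c`, hence each `q - 1` times; the upper bound per
  -- broken line counts them in the same way.
  set S : Finset ((V →ₗ[F] F) × F) :=
    (Finset.univ \ Finset.univ.image fun b : F => b • φ₀) ×ˢ Finset.univ with hS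
  have hScard : (Fintype.card V - Fintype.card F) * Fintype.card F ≤ S.card := by
    rw [hS, Finset.card_product, Finset.card_univ]
    refine Nat.mul_le_mul_right _ (le_trans ?_ (Finset.le_card_sdiff _ _))
    rw [Finset.card_univ, hdual]
    exact Nat.sub_le_sub_left Finset.card_image_le _
  have hSmem : ∀ p ∈ S, (∀ b : F, p.1 ≠ b • φ₀) := by
    intro p hp b hb
    simp only [hS, Finset.mem_product, Finset.mem_sdiff, Finset.mem_univ, true_and,
      Finset.mem_image, not_exists, and_true] at hp
    exact hp b hb.symm
  have hlow : ∀ p ∈ S, 2 * Fintype.card V +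
      Fintype.card F * (Fintype.card F * (Fintype.card F - 1)) ≤
      Fintype.card F * ((brokenIn f p.1 p.2).card * (Fintype.card F * (Fintype.card F - 1))
        + 2 * Fintype.card F) := by
    intro p hp
    obtain ⟨X, hX, hXp, hXb⟩ := hcon p.1 p.2 (hSmem p hp)
    exact card_brokenIn_ge hq hf (fun h => hSmem p hp 0 (by rw [h, zero_smul]))
      ⟨X, mem_brokenIn.2 ⟨⟨hX, hXb⟩, hXp⟩⟩
  have hdc : ∑ p ∈ S, (brokenIn f p.1 p.2).card ≤
      ∑ X ∈ B, (S.filter fun p => ∀ x ∈ X, p.1 x = p.2).card := by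
    have := Finset.sum_card_bipartiteAbove_eq_sum_card_bipartiteBelow (s := S) (t := B)
      (fun p X => ∀ x ∈ X, p.1 x = p.2)
    simp only [Finset.bipartiteAbove, Finset.bipartiteBelow] at this
    rw [← this]
    refine Finset.sum_le_sum fun p _ => Finset.card_le_card fun X hX => ?_
    rw [mem_brokenIn] at hX
    simpa [hBdef] using hX
  -- A line with direction `d` satisfies `φ = c` only if `φ d = 0`, and then `φ` determines `c`;
  -- there are `v / q - 1` nonzero such `φ`, where `v` is the size of `V`.
  have hup : ∀ X ∈ B, (S.filter fun p => ∀ x ∈ X, p.1 x = p.2).card * Fintype.card F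
      + Fintype.card F ≤ Fintype.card V := by
    intro X hX
    have hXb : X ∈ brokenLines F f := by simpa [hBdef] using hX
    obtain ⟨a, d, hd, rfl⟩ := isFlat_one_iff.1 hXb.1
    have hev : Module.Dual.eval F V d ≠ 0 := by
      rwa [Ne, Module.eval_apply_eq_zero_iff]
    have hc := card_level_mul hev 0
    have h0 : (0 : V →ₗ[F] F) ∈ Finset.univ.filter
        (fun φ : V →ₗ[F] F => Module.Dual.eval F V d φ = 0) :=
      Finset.mem_filter.2 ⟨Finset.mem_univ _, map_zero _⟩
    have hle : (S.filter fun p => ∀ x ∈ lineAt F a d, p.1 x = p.2).card ≤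
        ((Finset.univ.filter
          (fun φ : V →ₗ[F] F => Module.Dual.eval F V d φ = 0)).erase 0).card := by
      refine Finset.card_le_card_of_injOn Prod.fst ?_ ?_
      · intro p hp
        simp only [Finset.coe_filter, Set.mem_ofPred_eq] at hp
        have h1 := hp.2 _ (self_mem_lineAt a d)
        have h2 := hp.2 _ (add_mem_lineAt a d)
        rw [map_add, h1, add_eq_left] at h2
        exact Finset.mem_coe.2 (Finset.mem_erase.2
          ⟨fun h => hSmem p hp.1 0 (by rw [h, zero_smul]),
            Finset.mem_filter.2 ⟨Finset.mem_univ _, h2⟩⟩)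
      · intro p hp p' hp' h
        simp only [Finset.coe_filter, Set.mem_ofPred_eq] at hp hp'
        have h1 := hp.2 _ (self_mem_lineAt a d)
        have h2 := hp'.2 _ (self_mem_lineAt a d)
        exact Prod.ext h (by rw [← h1, ← h2, h])
    rw [Finset.card_erase_of_mem h0] at hle
    have hpos : 0 < (Finset.univ.filter
        (fun φ : V →ₗ[F] F => Module.Dual.eval F V d φ = 0)).card := Finset.card_pos.2 ⟨0, h0⟩
    have hc' : (Finset.univ.filter
        (fun φ : V →ₗ[F] F => Module.Dual.eval F V d φ = 0)).card * Fintype.card F =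
        Fintype.card V := by
      rw [← hdual, ← hc]
    rw [← hc', ← Nat.succ_mul]
    exact Nat.mul_le_mul_right _ (by omega)
  have hsum1 := Finset.sum_le_sum hlow
  have hsum2 := Finset.sum_le_sum hup
  simp only [Finset.sum_add_distrib, ← Finset.mul_sum, ← Finset.sum_mul, Finset.sum_const,
    smul_eq_mul] at hsum1 hsum2
  rw [hBc] at hsum2
  generalize ∑ p ∈ S, (brokenIn f p.1 p.2).card = A at *
  generalize ∑ X ∈ B, (S.filter fun p => ∀ x ∈ X, p.1 x = p.2).card = A' at *
  generalize (brokenLines F f).ncard = b at *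
  generalize S.card = s at *
  generalize Fintype.card V = v at *
  generalize Fintype.card F = q at *
  clear hlow hup hcon hSmem hBc hdual
  -- With `m + 1 = v - q`, the two counts would give `2 (v - q) + 2 q + q² (q - 3) ≤ 2 (v - q)`, up
  -- to a common positive factor. This is false for `q ≥ 3`.
  obtain ⟨j, rfl⟩ : ∃ j, q = j + 3 := ⟨q - 3, by omega⟩
  obtain ⟨m, rfl⟩ : ∃ m, v = j + 3 + (m + 1) := ⟨v - (j + 3) - 1, by omega⟩
  rw [Nat.add_sub_cancel_left] at hScard
  rw [show j + 3 - 1 = j + 2 from rfl] at hsum1 hB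
  have h1 : A' * (j + 3) ≤ b * (m + 1) := by nlinarith
  have h2 : (j + 2) * b ≤ 2 * (m + 1) := by nlinarith
  have h3 : (j + 2) * (A * (j + 3)) ≤ 2 * (m + 1) * (m + 1) :=
    calc (j + 2) * (A * (j + 3)) ≤ (j + 2) * (b * (m + 1)) :=
          Nat.mul_le_mul_left _ ((Nat.mul_le_mul_right _ hdc).trans h1)
      _ = (j + 2) * b * (m + 1) := by ring
      _ ≤ _ := Nat.mul_le_mul_right _ h2
  have h4 : s * (2 * (m + 1) + 2 * (j + 3) + (j + 3) * (j + 3) * j) ≤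
      (j + 3) * ((j + 2) * (A * (j + 3))) := by nlinarith
  have h5 : (m + 1) * (j + 3) * (2 * (m + 1) + 2 * (j + 3) + (j + 3) * (j + 3) * j) ≤
      (j + 3) * (2 * (m + 1) * (m + 1)) :=
    (Nat.mul_le_mul_right _ hScard).trans (h4.trans (Nat.mul_le_mul_left _ h3))
  have h6 : (m + 1) * (j + 3) * (2 * (m + 1) + 2 * (j + 3) + (j + 3) * (j + 3) * j) =
      (j + 3) * (2 * (m + 1) * (m + 1)) +
        (m + 1) * (j + 3) * (2 * (j + 3) + (j + 3) * (j + 3) * j) := by ring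
  have h7 : 0 < (m + 1) * (j + 3) * (2 * (j + 3) + (j + 3) * (j + 3) * j) := by positivity
  omega

end CleanHyperplanes

/-! ### Gluing semilinear maps along two hyperplanes -/

section Gluing

variable {F V : Type*} [Field F] [AddCommGroup V] [Module F V]

lemma exists_mem_indep_of_finrank [FiniteDimensional F V] {U : Submodule F V}
    (hU : 2 ≤ Module.finrank F U) (x : V) : ∃ z ∈ U, ∀ c : F, z ≠ c • x := by
  by_contra! h
  have hle : U ≤ Submodule.span F {x} := fun z hz => by
    obtain ⟨c, rfl⟩ := h z hz
    exact Submodule.smul_mem _ _ (Submodule.mem_span_singleton_self x)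
  have h1 := Submodule.finrank_mono hle
  have h2 := finrank_span_le_card (R := F) ({x} : Set V)
  simp at h2
  omega

lemma exists_eq_zero_eq_one {φ ψ : V →ₗ[F] F} (hψ : ψ ≠ 0) (h : ∀ b : F, φ ≠ b • ψ) :
    ∃ e, ψ e = 0 ∧ φ e = 1 := by
  obtain ⟨u, hu⟩ := LinearMap.surjective hψ 1
  have : ∃ x, ψ x = 0 ∧ φ x ≠ 0 := by
    by_contra! hcon
    refine h (φ u) (LinearMap.ext fun x => ?_)
    have := hcon (x - ψ x • u) (by simp [hu])
    rw [map_sub, map_smul, sub_eq_zero] at this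
    simp [this, mul_comm]
  obtain ⟨x, h1, h2⟩ := this
  exact ⟨(φ x)⁻¹ • x, by simp [h1], by simp [h2]⟩

lemma IsFlat.image_add_right {X : Set V} (hX : IsFlat F 1 X) (b : V) :
    IsFlat F 1 ((fun x => x + b) '' X) := by
  obtain ⟨a, d, hd, rfl⟩ := isFlat_one_iff.1 hX
  refine isFlat_one_iff.2 ⟨a + b, d, hd, ?_⟩
  ext y
  constructor
  · rintro ⟨_, ⟨t, rfl⟩, rfl⟩
    exact ⟨t, by module⟩
  · rintro ⟨t, rfl⟩
    exact ⟨a + t • d, ⟨t, rfl⟩, by module⟩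

/-- A function without broken lines in two hyperplanes meeting at the origin agrees there with a
semilinear bijection. -/
lemma exists_semilinear_of_clean [Fintype F] [Finite V] (hq : 2 < Fintype.card F)
    (hn : 3 ≤ Module.finrank F V) {f : V → V} (hf : Function.Injective f) (h0 : f 0 = 0)
    {φ ψ : V →ₗ[F] F} (hψ : ψ ≠ 0) (hφψ : ∀ b : F, φ ≠ b • ψ)
    (hφg : ∀ a ∈ LinearMap.ker φ, ∀ d ∈ LinearMap.ker φ, d ≠ 0 → IsFlat F 1 (f '' lineAt F a d))
    (hψg : ∀ a ∈ LinearMap.ker ψ, ∀ d ∈ LinearMap.ker ψ, d ≠ 0 → IsFlat F 1 (f '' lineAt F a d)) :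
    ∃ (σ : F ≃+* F) (g : V ≃+ V), (∀ (α : F) (x : V), g (α • x) = σ α • g x) ∧
      ∀ x, φ x = 0 ∨ ψ x = 0 → f x = g x := by
  have : Module.Finite F V := Module.Finite.of_finite
  have hker : ∀ χ : V →ₗ[F] F, 2 ≤ Module.finrank F (LinearMap.ker χ) := by
    intro χ
    have h1 := LinearMap.finrank_range_add_finrank_ker χ
    have h2 := Submodule.finrank_le (LinearMap.range χ)
    rw [Module.finrank_self] at h2
    omega
  have hUφ := exists_mem_indep_of_finrank (hker φ)
  have hUψ := exists_mem_indep_of_finrank (hker ψ)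
  obtain ⟨σ, hσ⟩ := exists_semilinear_of_lines hf h0 hφg hq hUφ
  obtain ⟨τ, hτ⟩ := exists_semilinear_of_lines hf h0 hψg hq hUψ
  have hadd := fun {x y : V} => map_add_of_lines hf h0 hφg hq hUφ (x := x) (y := y)
  have hadd' := fun {x y : V} => map_add_of_lines hf h0 hψg hq hUψ (x := x) (y := y)
  -- In dimension at least 3 the two kernels share a nonzero vector, where the two field
  -- automorphisms can be compared.
  have hστ : ∀ α, τ α = σ α := by
    intro α
    have hk : LinearMap.ker (φ.prod ψ) ≠ ⊥ := LinearMap.ker_ne_bot_of_finrank_lt (by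
      rw [Module.finrank_prod, Module.finrank_self]
      omega)
    obtain ⟨k, hk, hk0⟩ := Submodule.exists_mem_ne_zero_of_ne_bot hk
    simp only [LinearMap.mem_ker, LinearMap.prod_apply, Function.prod_apply, Prod.mk_eq_zero] at hk
    have h1 := hσ α k hk.1
    rw [hτ α k hk.2] at h1
    exact smul_left_injective F (fun h => hk0 (hf (h.trans h0.symm))) h1
  obtain ⟨e, he0, he1⟩ := exists_eq_zero_eq_one hψ hφψ
  have hm : ∀ x, x - φ x • e ∈ LinearMap.ker φ := fun x => by simp [he1]
  have hm' : ∀ t : F, t • e ∈ LinearMap.ker ψ := fun t => by simp [he0]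
  -- The splitting `V = ker φ ⊕ F e` with `e ∈ ker ψ` makes each summand lie in a kernel where `f`
  -- is already additive.
  let g : V →+ V :=
    { toFun := fun x => f (x - φ x • e) + f (φ x • e)
      map_zero' := by simp [h0]
      map_add' := fun x y => by
        rw [map_add, add_smul, hadd' (hm' _) (hm' _), add_sub_add_comm, hadd (hm x) (hm y)]
        abel }
  have hg : ∀ x, g x = f (x - φ x • e) + f (φ x • e) := fun _ => rfl
  have hgφ : ∀ x, φ x = 0 → f x = g x := fun x hx => by simp [hg, hx, h0]
  have hinj : Function.Injective g := by
    rw [injective_iff_map_eq_zero]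
    intro x hx
    have h1 := hadd (hm x) (Submodule.neg_mem _ (hm x))
    rw [add_neg_cancel, h0] at h1
    have h2 : f (φ x • e) = f (-(x - φ x • e)) := by
      rw [hg, h1] at hx
      exact add_left_cancel hx
    have h3 : φ x = 0 := by
      have := congrArg φ (hf h2)
      simpa [he1] using this
    rw [← hgφ x h3] at hx
    exact hf (hx.trans h0.symm)
  refine ⟨σ, AddEquiv.ofBijective g (Finite.injective_iff_bijective.1 hinj), ?_, ?_⟩
  · intro α x
    simp only [AddEquiv.ofBijective_apply, hg, map_smul, smul_eq_mul, mul_smul, ← smul_sub]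
    rw [hσ α _ (hm x), hτ α _ (hm' _), hστ, smul_add]
  · rintro x (hx | hx)
    · exact hgφ x hx
    · have h1 : x - φ x • e ∈ LinearMap.ker ψ := Submodule.sub_mem _ hx (hm' _)
      have := hadd' h1 (hm' (φ x))
      rw [sub_add_cancel] at this
      exact this

/-- A function without broken lines in two nonparallel hyperplanes agrees there with a semiaffine
permutation. -/
lemma exists_semiAffine_of_clean [Fintype F] [Finite V] (hq : 2 < Fintype.card F)
    (hn : 3 ≤ Module.finrank F V) {f : V → V} (hf : Function.Injective f)
    {φ ψ : V →ₗ[F] F} {a b : F} (hψ : ψ ≠ 0) (hφψ : ∀ b : F, φ ≠ b • ψ)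
    (hφg : ∀ X, IsFlat F 1 X → (∀ x ∈ X, φ x = a) → IsFlat F 1 (f '' X))
    (hψg : ∀ X, IsFlat F 1 X → (∀ x ∈ X, ψ x = b) → IsFlat F 1 (f '' X)) :
    ∃ G : Equiv.Perm V, IsSemiAffine F G ∧ ∀ x, φ x = a ∨ ψ x = b → f x = G x := by
  obtain ⟨e, he0, he1⟩ := exists_eq_zero_eq_one hψ hφψ
  obtain ⟨u, hu⟩ := LinearMap.surjective hψ b
  obtain ⟨o, hoφ, hoψ⟩ : ∃ o, φ o = a ∧ ψ o = b :=
    ⟨u + (a - φ u) • e, by simp [he1], by simp [he0, hu]⟩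
  -- Translating a common point `o` of the hyperplanes and its image to the origin reduces to the
  -- linear case.
  have hclean : ∀ (χ : V →ₗ[F] F), (∀ X, IsFlat F 1 X → (∀ x ∈ X, χ x = χ o) →
      IsFlat F 1 (f '' X)) → ∀ p ∈ LinearMap.ker χ, ∀ d ∈ LinearMap.ker χ, d ≠ 0 →
      IsFlat F 1 ((fun x => f (o + x) - f o) '' lineAt F p d) := by
    intro χ hχ p hp d hd hd0
    have h1 := hχ (lineAt F (o + p) d) (isFlat_lineAt _ hd0) (by
      rintro _ ⟨t, rfl⟩
      rw [LinearMap.mem_ker] at hp hd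
      simp [hp, hd])
    convert h1.image_add_right (-f o) using 1
    ext y
    constructor
    · rintro ⟨_, ⟨t, rfl⟩, rfl⟩
      exact ⟨_, ⟨_, ⟨t, rfl⟩, rfl⟩, by simp [add_assoc, sub_eq_add_neg]⟩
    · rintro ⟨_, ⟨_, ⟨t, rfl⟩, rfl⟩, rfl⟩
      exact ⟨_, ⟨t, rfl⟩, by simp [add_assoc, sub_eq_add_neg]⟩
  obtain ⟨σ, g, hg, hfg⟩ := exists_semilinear_of_clean hq hn
    (f := fun x => f (o + x) - f o) (fun x y h => add_left_cancel (hf (sub_left_injective h)))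
    (by simp) hψ hφψ (hclean φ (hoφ ▸ hφg)) (hclean ψ (hoψ ▸ hψg))
  refine ⟨g.toEquiv.trans (Equiv.addRight (f o - g o)), ⟨σ, g, f o - g o, hg, fun x => rfl⟩, ?_⟩
  intro x hx
  have := hfg (x - o) (by simpa [hoφ, hoψ, sub_eq_zero] using hx)
  simp only [add_sub_cancel, map_sub] at this
  change f x = g x + (f o - g o)
  rw [sub_eq_iff_eq_add.1 this]
  abel

end Gluing

/-! ### Counting broken lines through moved points -/

section MovedPoints

variable {F V : Type*} [Field F] [AddCommGroup V] [Module F V]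

open Classical in
/-- The points moved by `f`. -/
noncomputable def movedPoints {V : Type*} [Fintype V] (f : V → V) : Finset V :=
  Finset.univ.filter fun x => f x ≠ x

omit [AddCommGroup V] [Field F] [Module F V] in
lemma mem_movedPoints [Fintype V] {f : V → V} {x : V} : x ∈ movedPoints f ↔ f x ≠ x := by
  classical
  simp [movedPoints]

lemma image_eq_of_fixed {f : V → V} {X : Set V} (hX : IsFlat F 1 X) (hfX : IsFlat F 1 (f '' X))
    {y z : V} (hy : y ∈ X) (hz : z ∈ X) (hyz : y ≠ z) (hfy : f y = y) (hfz : f z = z) :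
    f '' X = X :=
  hfX.eq_of_mem hX hyz ⟨y, hy, hfy⟩ ⟨z, hz, hfz⟩ hy hz

/-- Lines with exactly one moved point are broken; there are many of them if few points move. -/
lemma card_movedPoints_mul_le [Fintype F] [Fintype V] (hq : 2 < Fintype.card F) {f : V → V}
    (hf : Function.Injective f) :
    (movedPoints f).card * (Fintype.card V - 1) ≤
      (brokenLines F f).ncard * (Fintype.card F - 1) +
      (movedPoints f).card * (((movedPoints f).card - 1) * (Fintype.card F - 1)) := by
  classical
  set D := movedPoints f with hD
  -- For `y ∈ Y x` the point `x` is the only moved point on the line `x y`. Were this line not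
  -- broken, its at least two fixed points would make it invariant, and `f x`, again a moved point,
  -- would be a second one on it.
  set Y : V → Finset V := fun x => Finset.univ.erase x \
    (D.erase x).biUnion fun z => (lineAt F x (z - x)).toFinset.erase x with hY
  have hYmem : ∀ x y, y ∈ Y x → y ≠ x ∧ ∀ z ∈ D, z ≠ x → y ∉ lineAt F x (z - x) := by
    intro x y hy
    simp only [hY, Finset.mem_sdiff, Finset.mem_erase, Finset.mem_univ, and_true,
      Finset.mem_biUnion, Set.mem_toFinset, not_exists, not_and] at hy
    exact ⟨hy.1, fun z hz hzx => hy.2 z ⟨hzx, hz⟩ hy.1⟩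
  have hYcard : ∀ x ∈ D, Fintype.card V - 1 ≤ (Y x).card + (D.card - 1) * (Fintype.card F - 1) := by
    intro x hx
    have h1 := Finset.le_card_sdiff
      ((D.erase x).biUnion fun z => (lineAt F x (z - x)).toFinset.erase x) (Finset.univ.erase x)
    have h2 := Finset.card_biUnion_le_card_mul (D.erase x)
      (fun z => (lineAt F x (z - x)).toFinset.erase x) (Fintype.card F - 1) (by
        intro z hz
        rw [Finset.card_erase_of_mem (Set.mem_toFinset.2 (self_mem_lineAt _ _)),
          ← Set.ncard_eq_toFinset_card', (isFlat_join (Finset.ne_of_mem_erase hz).symm).ncard_eq,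
          Nat.card_eq_fintype_card])
    rw [Finset.card_erase_of_mem hx] at h2
    rw [Finset.card_erase_of_mem (Finset.mem_univ x), Finset.card_univ] at h1
    change _ ≤ (Y x).card at h1
    omega
  have huniq : ∀ x y z, y ∈ Y x → z ∈ D → z ∈ lineAt F x (y - x) → z = x := by
    intro x y z hy hz hzX
    by_contra hzx
    obtain ⟨hyx, hy⟩ := hYmem x y hy
    refine hy z hz hzx ?_
    rw [← lineAt_eq_of_mem (self_mem_lineAt _ _) hzX (Ne.symm hzx)]
    exact right_mem_lineAt x y
  have hbroken : ∀ x ∈ D, ∀ y ∈ Y x, lineAt F x (y - x) ∈ brokenLines F f := by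
    intro x hx y hy
    have hyx := (hYmem x y hy).1
    have hX := isFlat_join (F := F) hyx.symm
    refine ⟨hX, fun hgood => ?_⟩
    obtain ⟨z, hz, hzx, hzy⟩ := hX.exists_third hq x y
    have hfix : ∀ w ∈ lineAt F x (y - x), w ≠ x → f w = w := fun w hw hwx => by
      by_contra hne
      exact hwx (huniq x y w hy (mem_movedPoints.2 hne) hw)
    have himg := image_eq_of_fixed hX hgood (right_mem_lineAt x y) hz hzy.symm
      (hfix y (right_mem_lineAt x y) hyx) (hfix z hz hzx)
    have hfx : f x ∈ lineAt F x (y - x) := himg ▸ Set.mem_image_of_mem f (self_mem_lineAt _ _)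
    have hmx : f x ≠ x := mem_movedPoints.1 hx
    exact hmx (huniq x y (f x) hy (mem_movedPoints.2 fun h => hmx (hf h)) hfx)
  -- A broken line arises from at most `q - 1` pairs, since `x` is its unique moved point.
  have key := Finset.card_mul_le_card_mul (m := 1) (n := Fintype.card F - 1)
    (fun (p : Σ _ : V, V) (X : Set V) => X = lineAt F p.1 (p.2 - p.1))
    (s := D.sigma Y) (t := (Set.toFinite (brokenLines F f)).toFinset) ?_ ?_
  · rw [mul_one, Finset.card_sigma, ← Set.ncard_eq_toFinset_card] at key
    have := Finset.sum_le_sum hYcard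
    rw [Finset.sum_const, Finset.sum_add_distrib, Finset.sum_const, smul_eq_mul,
      smul_eq_mul] at this
    omega
  · rintro ⟨x, y⟩ hp
    rw [Finset.mem_sigma] at hp
    refine Finset.card_pos.2 ⟨lineAt F x (y - x), ?_⟩
    simpa [Finset.mem_bipartiteAbove] using hbroken x hp.1 y hp.2
  · intro X _
    rcases (Finset.bipartiteBelow (fun (p : Σ _ : V, V) (X : Set V) =>
      X = lineAt F p.1 (p.2 - p.1)) (D.sigma Y) X).eq_empty_or_nonempty with he | ⟨⟨x, y⟩, hxy⟩
    · simp [he]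
    simp only [Finset.mem_bipartiteBelow, Finset.mem_sigma] at hxy
    obtain ⟨⟨hx, hy⟩, rfl⟩ := hxy
    have hyx := (hYmem x y hy).1
    calc _ ≤ ((lineAt F x (y - x)).toFinset.erase x).card := by
          refine Finset.card_le_card_of_injOn (fun p => p.2) ?_ ?_
          · rintro ⟨x', y'⟩ hp
            simp only [Finset.mem_coe, Finset.mem_bipartiteBelow, Finset.mem_sigma] at hp
            have hx' : x' = x := huniq x y x' hy hp.1.1 (hp.2 ▸ self_mem_lineAt _ _)
            subst hx'
            simp only [Finset.coe_erase, Set.coe_toFinset]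
            exact ⟨hp.2 ▸ right_mem_lineAt _ _, (hYmem _ _ hp.1.2).1⟩
          · rintro ⟨x₁, y₁⟩ hp₁ ⟨x₂, y₂⟩ hp₂ h
            simp only [Finset.mem_coe, Finset.mem_bipartiteBelow, Finset.mem_sigma] at hp₁ hp₂ h
            have h1 := huniq x y x₁ hy hp₁.1.1 (hp₁.2 ▸ self_mem_lineAt _ _)
            have h2 := huniq x y x₂ hy hp₂.1.1 (hp₂.2 ▸ self_mem_lineAt _ _)
            rw [h1, h2, h]
      _ = _ := by
        rw [Finset.card_erase_of_mem (Set.mem_toFinset.2 (self_mem_lineAt _ _)),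
          ← Set.ncard_eq_toFinset_card', (isFlat_join hyx.symm).ncard_eq,
          Nat.card_eq_fintype_card]

lemma card_level₂_mul [Fintype F] [Fintype V] [DecidableEq F] {φ ψ : V →ₗ[F] F} (hψ : ψ ≠ 0)
    (hφψ : ∀ b : F, φ ≠ b • ψ) (a b : F) :
    (Finset.univ.filter fun y => φ y = a ∧ ψ y = b).card * (Fintype.card F * Fintype.card F) =
      Fintype.card V := by
  classical
  obtain ⟨e, he0, he1⟩ := exists_eq_zero_eq_one hψ hφψ
  have hT : Function.Surjective (φ.prod ψ) := by
    rintro ⟨x, y⟩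
    obtain ⟨u, hu⟩ := LinearMap.surjective hψ y
    exact ⟨u + (x - φ u) • e, by simp [he0, he1, hu]⟩
  rw [← card_fiber_mul hT (a, b), Fintype.card_prod]
  congr 2
  ext y
  simp

/-- A function that fixes two nonparallel hyperplanes pointwise and has few broken lines moves few
points. -/
lemma card_movedPoints_le_of_fixed [Fintype F] [Fintype V] (hq : 2 < Fintype.card F) {f : V → V}
    (hf : Function.Injective f) {φ ψ : V →ₗ[F] F} {a b : F} (hψ : ψ ≠ 0)
    (hφψ : ∀ b : F, φ ≠ b • ψ) (hfix : ∀ x, φ x = a ∨ ψ x = b → f x = x) {N : ℕ}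
    (hN : Fintype.card V = N * (Fintype.card F * Fintype.card F)) :
    (movedPoints f).card * (2 * N - 1) ≤ 2 * (brokenLines F f).ncard := by
  classical
  set D := movedPoints f with hD
  have hDφ : ∀ x ∈ D, φ x ≠ a := fun x hx h => mem_movedPoints.1 hx (hfix x (.inl h))
  have hDψ : ∀ x ∈ D, ψ x ≠ b := fun x hx h => mem_movedPoints.1 hx (hfix x (.inr h))
  have hq0 : 0 < Fintype.card F := by omega
  have hlev : ∀ t, (Finset.univ.filter fun y => φ y = a ∧ ψ y = t).card = N := fun t => by
    have := card_level₂_mul hψ hφψ a t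
    rw [hN] at this
    exact Nat.eq_of_mul_eq_mul_right (by positivity) this
  have hlev1 : (Finset.univ.filter fun y => φ y = a).card = Fintype.card F * N := by
    have := card_level_mul (φ := φ) (fun h => hφψ 0 (by rw [h, zero_smul])) a
    rw [hN] at this
    refine Nat.eq_of_mul_eq_mul_right hq0 (this.trans (by ring))
  -- the second point of the line `x y` in the union of the hyperplanes
  have hmeet : ∀ x y, ψ y ≠ ψ x → ψ y ≠ b → ∃ z ∈ lineAt F x (y - x), ψ z = b ∧ z ≠ y := by
    intro x y hxy hyb
    have h0 : ψ y - ψ x ≠ 0 := sub_ne_zero.2 hxy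
    have hz : ψ (x + ((b - ψ x) / (ψ y - ψ x)) • (y - x)) = b := by
      rw [map_add, map_smul, map_sub, smul_eq_mul, div_mul_cancel₀ _ h0, add_sub_cancel]
    exact ⟨_, ⟨_, rfl⟩, hz, fun h => hyb (h ▸ hz)⟩
  -- The conditions on `ψ y` make the line `x y` meet the second hyperplane in another fixed point.
  -- Two fixed points force an unbroken line to be invariant, which `f x` off the line forbids.
  set Y : V → Finset V := fun x => Finset.univ.filter fun y =>
    (φ y = a ∧ ψ y ≠ b ∧ ψ y ≠ ψ x) ∧ f x ∉ lineAt F x (y - x) with hY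
  have hYmem : ∀ x y, y ∈ Y x ↔ (φ y = a ∧ ψ y ≠ b ∧ ψ y ≠ ψ x) ∧ f x ∉ lineAt F x (y - x) := by
    simp [hY]
  have hlineφ : ∀ x y y', φ x ≠ a → φ y = a → φ y' = a → y' ∈ lineAt F x (y - x) → y' = y := by
    rintro x y y' hx hy hy' ⟨t, rfl⟩
    have h1 : (t - 1) * (a - φ x) = 0 := by
      rw [map_add, map_smul, map_sub, hy, smul_eq_mul] at hy'
      linear_combination hy'
    have h2 : t = 1 := by
      rcases mul_eq_zero.1 h1 with h | h
      · exact sub_eq_zero.1 h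
      · exact absurd (sub_eq_zero.1 h).symm hx
    simp [h2]
  have hYcard : ∀ x ∈ D, (2 * N - 1) * (Fintype.card F - 2) ≤ 2 * (Y x).card := by
    intro x hx
    have hxb := (hDψ x hx).symm
    set Z := Finset.univ.filter fun y => (φ y = a ∧ ψ y ≠ b ∧ ψ y ≠ ψ x) with hZ
    set Z' := Z.filter fun y => f x ∈ lineAt F x (y - x) with hZ'
    have hZsplit : (Y x).card + Z'.card = Z.card := by
      rw [← Finset.card_filter_add_card_filter_not (s := Z)
        (fun y => f x ∈ lineAt F x (y - x)), add_comm]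
      congr 2
      ext y
      simp [hY, hZ]
    have hZcard : Z.card = N * (Fintype.card F - 2) := by
      have h1 : (Finset.univ.filter fun y => φ y = a) = Z ∪
          ((Finset.univ.filter fun y => φ y = a ∧ ψ y = b) ∪
            (Finset.univ.filter fun y => φ y = a ∧ ψ y = ψ x)) := by
        ext y
        simp only [hZ, Finset.mem_filter, Finset.mem_union, Finset.mem_univ, true_and]
        tauto
      have h2 : Disjoint (Finset.univ.filter fun y => φ y = a ∧ ψ y = b)
          (Finset.univ.filter fun y => φ y = a ∧ ψ y = ψ x) := by
        rw [Finset.disjoint_filter]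
        rintro y - h h'
        exact hxb (h.2.symm.trans h'.2)
      have h3 : Disjoint Z ((Finset.univ.filter fun y => φ y = a ∧ ψ y = b) ∪
            (Finset.univ.filter fun y => φ y = a ∧ ψ y = ψ x)) := by
        rw [← Finset.filter_or, Finset.disjoint_filter]
        rintro y - h h'
        tauto
      have h4 := congrArg Finset.card h1
      rw [Finset.card_union_of_disjoint h3, Finset.card_union_of_disjoint h2, hlev, hlev,
        hlev1] at h4
      obtain ⟨k, hk⟩ : ∃ k, Fintype.card F = k + 2 := ⟨Fintype.card F - 2, by omega⟩
      rw [hk] at h4 ⊢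
      simp only [Nat.add_sub_cancel]
      linarith
    have hZ'1 : Z'.card ≤ 1 := by
      refine Finset.card_le_one.2 fun y hy y' hy' => ?_
      simp only [hZ', hZ, Finset.mem_filter, Finset.mem_univ, true_and] at hy hy'
      have hmx : f x ≠ x := mem_movedPoints.1 hx
      have e : lineAt F x (y - x) = lineAt F x (y' - x) := by
        rw [lineAt_eq_of_mem (self_mem_lineAt _ _) hy.2 hmx.symm,
          lineAt_eq_of_mem (self_mem_lineAt _ _) hy'.2 hmx.symm]
      exact hlineφ x y' y (hDφ x hx) hy'.1.1 hy.1.1 (e ▸ right_mem_lineAt _ _)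
    -- In general one `y` may be lost, which costs at most `(q - 2) / 2` only if `q ≥ 4`. For `q =
    -- 3` none is lost: the line would contain the four distinct points `f x`, `x`, `y`, `z`.
    have hZ'0 : Fintype.card F = 3 → Z'.card = 0 := by
      intro h3
      rw [Finset.card_eq_zero, Finset.eq_empty_iff_forall_notMem]
      intro y hy
      simp only [hZ', hZ, Finset.mem_filter, Finset.mem_univ, true_and] at hy
      obtain ⟨⟨hya, hyb, hyx⟩, hfx⟩ := hy
      obtain ⟨z, hz, hzb, hzy⟩ := hmeet x y hyx hyb
      have hmx : f x ≠ x := mem_movedPoints.1 hx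
      have hfy := hfix y (.inl hya)
      have hfz := hfix z (.inr hzb)
      have hxy : x ≠ y := fun h => hyx (by rw [h])
      have hxz : x ≠ z := fun h => hmx (h ▸ hfz)
      have h4 : ({f x, x, y, z} : Finset V) ⊆ (lineAt F x (y - x)).toFinset := by
        intro w hw
        simp only [Finset.mem_insert, Finset.mem_singleton] at hw
        rw [Set.mem_toFinset]
        rcases hw with rfl | rfl | rfl | rfl
        exacts [hfx, self_mem_lineAt _ _, right_mem_lineAt _ _, hz]
      have h5 := Finset.card_le_card h4
      rw [← Set.ncard_eq_toFinset_card', (isFlat_join hxy).ncard_eq, Nat.card_eq_fintype_card, h3,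
        Finset.card_insert_of_notMem, Finset.card_insert_of_notMem, Finset.card_pair hzy.symm] at h5
      · omega
      · simp [hxy, hxz]
      · simp only [Finset.mem_insert, Finset.mem_singleton, not_or]
        exact ⟨hmx, fun h => hxy (hf (h.trans hfy.symm)), fun h => hxz (hf (h.trans hfz.symm))⟩
    obtain ⟨k, hk⟩ : ∃ k, Fintype.card F = k + 3 := ⟨Fintype.card F - 3, by omega⟩
    have e : (2 * N - 1) * (k + 1) = 2 * (N * (k + 1)) - (k + 1) := by
      rw [Nat.sub_mul, one_mul, mul_assoc]
    rw [hk, show k + 3 - 2 = k + 1 by omega] at hZcard ⊢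
    rw [hk] at hZ'0
    rw [e]
    rcases Nat.eq_zero_or_pos k with rfl | hk0
    · have := hZ'0 rfl
      omega
    · omega
  have hbroken : ∀ x ∈ D, ∀ y ∈ Y x, lineAt F x (y - x) ∈ brokenLines F f := by
    intro x hx y hy
    obtain ⟨⟨hya, hyb, hyx⟩, hfx⟩ := (hYmem x y).1 hy
    have hxy : x ≠ y := fun h => hyx (by rw [h])
    refine ⟨isFlat_join hxy, fun hgood => hfx ?_⟩
    obtain ⟨z, hz, hzb, hzy⟩ := hmeet x y hyx hyb
    rw [← image_eq_of_fixed (isFlat_join hxy) hgood hz (right_mem_lineAt x y) hzy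
      (hfix z (.inr hzb)) (hfix y (.inl hya))]
    exact Set.mem_image_of_mem f (self_mem_lineAt _ _)
  -- On a given broken line, `x` avoids the two fixed points and determines the pair, because the
  -- line meets `φ = a` only in `y`.
  have key := Finset.card_mul_le_card_mul (m := 1) (n := Fintype.card F - 2)
    (fun (p : Σ _ : V, V) (X : Set V) => X = lineAt F p.1 (p.2 - p.1))
    (s := D.sigma Y) (t := (Set.toFinite (brokenLines F f)).toFinset) ?_ ?_
  · rw [mul_one, Finset.card_sigma, ← Set.ncard_eq_toFinset_card] at key
    have h1 := Finset.sum_le_sum hYcard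
    rw [Finset.sum_const, smul_eq_mul, ← Finset.mul_sum] at h1
    refine Nat.le_of_mul_le_mul_right (c := Fintype.card F - 2) ?_ (by omega)
    rw [mul_assoc, mul_assoc]
    exact h1.trans (Nat.mul_le_mul_left 2 key)
  · rintro ⟨x, y⟩ hp
    rw [Finset.mem_sigma] at hp
    refine Finset.card_pos.2 ⟨lineAt F x (y - x), ?_⟩
    simpa [Finset.mem_bipartiteAbove] using hbroken x hp.1 y hp.2
  · intro X _
    rcases (Finset.bipartiteBelow (fun (p : Σ _ : V, V) (X : Set V) =>
      X = lineAt F p.1 (p.2 - p.1)) (D.sigma Y) X).eq_empty_or_nonempty with he | ⟨⟨x, y⟩, hxy⟩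
    · simp [he]
    simp only [Finset.mem_bipartiteBelow, Finset.mem_sigma] at hxy
    obtain ⟨⟨hx, hy⟩, rfl⟩ := hxy
    obtain ⟨⟨hya, hyb, hyx⟩, -⟩ := (hYmem x y).1 hy
    have hxy : x ≠ y := fun h => hyx (by rw [h])
    obtain ⟨z, hz, hzb, hzy⟩ := hmeet x y hyx hyb
    calc _ ≤ ((lineAt F x (y - x)).toFinset \ {y, z}).card := by
          refine Finset.card_le_card_of_injOn (fun p => p.1) ?_ ?_
          · rintro ⟨x', y'⟩ hp
            simp only [Finset.mem_coe, Finset.mem_bipartiteBelow, Finset.mem_sigma] at hp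
            simp only [Finset.coe_sdiff, Set.coe_toFinset]
            refine ⟨hp.2 ▸ self_mem_lineAt _ _, fun h => ?_⟩
            simp only [Finset.coe_insert, Finset.coe_singleton, Set.mem_insert_iff,
              Set.mem_singleton_iff] at h
            rcases h with rfl | rfl
            · exact hDφ _ hp.1.1 hya
            · exact hDψ _ hp.1.1 hzb
          · rintro ⟨x₁, y₁⟩ hp₁ ⟨x₂, y₂⟩ hp₂ h
            simp only [Finset.mem_coe, Finset.mem_bipartiteBelow, Finset.mem_sigma] at hp₁ hp₂ h
            have h1 := hlineφ x y y₁ (hDφ x hx) hya ((hYmem _ _).1 hp₁.1.2).1.1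
              (hp₁.2 ▸ right_mem_lineAt _ _)
            have h2 := hlineφ x y y₂ (hDφ x hx) hya ((hYmem _ _).1 hp₂.1.2).1.1
              (hp₂.2 ▸ right_mem_lineAt _ _)
            rw [h, h1, h2]
      _ = _ := by
        rw [Finset.card_sdiff_of_subset, ← Set.ncard_eq_toFinset_card', (isFlat_join hxy).ncard_eq,
          Nat.card_eq_fintype_card, Finset.card_pair hzy.symm]
        intro w hw
        simp only [Finset.mem_insert, Finset.mem_singleton] at hw
        rw [Set.mem_toFinset]
        rcases hw with rfl | rfl
        exacts [right_mem_lineAt _ _, hz]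

end MovedPoints

/-! ### Lines broken by a transposition -/

section Transpositions

variable {F V : Type*} [Field F] [AddCommGroup V] [Module F V]

lemma exists_linearEquiv_apply_eq [FiniteDimensional F V] {x y : V} (hx : x ≠ 0) (hy : y ≠ 0) :
    ∃ g : V ≃ₗ[F] V, g x = y := by
  obtain ⟨g, hg⟩ := Submodule.exists_linearEquiv_restrict_eq
    ((LinearEquiv.toSpanNonzeroSingleton F V x hx).symm.trans
      (LinearEquiv.toSpanNonzeroSingleton F V y hy))
  refine ⟨g, ?_⟩
  have := hg (LinearEquiv.toSpanNonzeroSingleton F V x hx 1)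
  rw [LinearEquiv.trans_apply, LinearEquiv.symm_apply_apply] at this
  simpa using this.symm

omit [Field F] [AddCommGroup V] [Module F V] in
lemma card_movedPoints_perm [Fintype V] [DecidableEq V] (f : Equiv.Perm V) :
    (movedPoints f).card = f.support.card := by
  congr 1
  ext x
  simp [mem_movedPoints]

/-- The number of lines broken by a transposition is at most the number of lines that contain
exactly one of the two points. -/
lemma ncard_brokenLines_swap_mul_le [Fintype F] [Fintype V] [DecidableEq V] {s t : V}
    (hst : s ≠ t) :
    (brokenLines F (Equiv.swap s t)).ncard * (Fintype.card F - 1) ≤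
      2 * (Fintype.card V - Fintype.card F) := by
  classical
  have hone : ∀ X ∈ brokenLines F (Equiv.swap s t), (s ∈ X ∧ t ∉ X) ∨ (t ∈ X ∧ s ∉ X) := by
    intro X hX
    by_contra hcon
    refine hX.2 ?_
    have himg : (Equiv.swap s t) '' X = X := by
      have hsub : (Equiv.swap s t) '' X ⊆ X := by
        rintro _ ⟨x, hx, rfl⟩
        by_cases hxs : x = s
        · subst hxs
          rw [Equiv.swap_apply_left]
          tauto
        by_cases hxt : x = t
        · subst hxt
          rw [Equiv.swap_apply_right]
          tauto
        rwa [Equiv.swap_apply_of_ne_of_ne hxs hxt]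
      exact Set.eq_of_subset_of_ncard_le hsub
        (Set.ncard_image_of_injective _ (Equiv.injective _)).ge (Set.toFinite _)
    rw [himg]
    exact hX.1
  -- A broken line contains exactly one of `s`, `t`, and its other `q - 1` points avoid the line `s
  -- t`; each pair of points determines its line.
  have key := Finset.card_mul_le_card_mul (m := Fintype.card F - 1) (n := 1)
    (fun (X : Set V) (p : V × V) => p.1 ∈ X ∧ p.2 ∈ X)
    (s := (Set.toFinite (brokenLines F (Equiv.swap s t))).toFinset)
    (t := {s, t} ×ˢ (Finset.univ \ (lineAt F s (t - s)).toFinset)) ?_ ?_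
  · rw [mul_one, Finset.card_product, Finset.card_pair hst, ← Set.ncard_eq_toFinset_card,
      Finset.card_sdiff_of_subset (Finset.subset_univ _), ← Set.ncard_eq_toFinset_card',
      (isFlat_join hst).ncard_eq, Nat.card_eq_fintype_card, Finset.card_univ] at key
    exact key
  · intro X hX
    have hXb : X ∈ brokenLines F (Equiv.swap s t) := by simpa using hX
    obtain ⟨p, hp, hpX, hnot⟩ : ∃ p, (p = s ∨ p = t) ∧ p ∈ X ∧ ¬ (s ∈ X ∧ t ∈ X) := by
      rcases hone X hXb with h | h
      · exact ⟨s, .inl rfl, h.1, fun h' => h.2 h'.2⟩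
      · exact ⟨t, .inr rfl, h.1, fun h' => h.2 h'.1⟩
    have hpL : p ∈ lineAt F s (t - s) := by
      rcases hp with rfl | rfl
      exacts [self_mem_lineAt _ _, right_mem_lineAt _ _]
    calc Fintype.card F - 1 = (X.toFinset.erase p).card := by
          rw [Finset.card_erase_of_mem (Set.mem_toFinset.2 hpX), ← Set.ncard_eq_toFinset_card',
            hXb.1.ncard_eq, Nat.card_eq_fintype_card]
      _ ≤ _ := by
        refine Finset.card_le_card_of_injOn (fun y => (p, y)) ?_ ?_
        · intro y hy
          simp only [Finset.coe_erase, Set.coe_toFinset] at hy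
          simp only [Finset.mem_coe, Finset.mem_bipartiteAbove, Finset.mem_product,
            Finset.mem_insert, Finset.mem_singleton, Finset.mem_sdiff, Finset.mem_univ, true_and,
            Set.mem_toFinset]
          refine ⟨⟨hp, fun hyL => hnot ?_⟩, hpX, hy.1⟩
          have hyp : p ≠ y := fun h => hy.2 h.symm
          rw [hXb.1.eq_of_mem (isFlat_join hst) hyp hpX hy.1 hpL hyL]
          exact ⟨self_mem_lineAt _ _, right_mem_lineAt _ _⟩
        · intro y _ y' _ h
          exact (Prod.mk.inj h).2
  · rintro ⟨p, y⟩ hpy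
    simp only [Finset.mem_product, Finset.mem_insert, Finset.mem_singleton, Finset.mem_sdiff,
      Finset.mem_univ, true_and, Set.mem_toFinset] at hpy
    have hpne : p ≠ y := by
      rintro rfl
      rcases hpy.1 with rfl | rfl
      exacts [hpy.2 (self_mem_lineAt _ _), hpy.2 (right_mem_lineAt _ _)]
    refine Finset.card_le_one.2 fun X hX X' hX' => ?_
    simp only [Finset.mem_bipartiteBelow, Set.Finite.mem_toFinset] at hX hX'
    exact hX.1.1.eq_of_mem hX'.1.1 hpne hX.2.1 hX.2.2 hX'.2.1 hX'.2.2

/-- The exact number of lines broken by a transposition. -/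
lemma ncard_brokenLines_swap [Fintype F] [Fintype V] [DecidableEq V] (hq : 2 < Fintype.card F)
    {s t : V} (hst : s ≠ t) :
    (brokenLines F (Equiv.swap s t)).ncard * (Fintype.card F - 1) =
      2 * (Fintype.card V - Fintype.card F) := by
  refine (ncard_brokenLines_swap_mul_le hst).antisymm ?_
  -- The estimate for two moved points is the reverse inequality.
  have h := card_movedPoints_mul_le (F := F) hq (Equiv.swap s t).injective
  rw [card_movedPoints_perm, Equiv.Perm.card_support_swap hst] at h
  omega

end Transpositions

/-! ### Semiaffine invariance and the classification of near-minimal permutations -/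

section SemiAffine

variable {F : Type*} [Field F] {n : ℕ}

lemma IsSemiAffine.isFlat_image {V : Type*} [AddCommGroup V] [Module F V] {G : Equiv.Perm V}
    (hG : IsSemiAffine F G) {X : Set V} (hX : IsFlat F 1 X) : IsFlat F 1 (G '' X) := by
  obtain ⟨σ, g, b, hg, hGg⟩ := hG
  obtain ⟨a, d, hd, rfl⟩ := isFlat_one_iff.1 hX
  refine isFlat_one_iff.2 ⟨g a + b, g d, by simpa using hd, ?_⟩
  ext y
  constructor
  · rintro ⟨_, ⟨t, rfl⟩, rfl⟩
    exact ⟨σ t, by rw [hGg, map_add, hg]; abel⟩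
  · rintro ⟨t, rfl⟩
    refine ⟨_, ⟨σ.symm t, rfl⟩, ?_⟩
    rw [hGg, map_add, hg, RingEquiv.apply_symm_apply]
    abel

lemma isFlat_image_iff_of_mem_AGammaL {G : Equiv.Perm (Fin n → F)} (hG : G ∈ AGammaL n F)
    {X : Set (Fin n → F)} : IsFlat F 1 (G '' X) ↔ IsFlat F 1 X := by
  refine ⟨fun h => ?_, fun h => IsSemiAffine.isFlat_image hG h⟩
  have h' := IsSemiAffine.isFlat_image ((AGammaL n F).inv_mem hG) h
  rwa [← Set.image_comp, ← Equiv.Perm.coe_mul, inv_mul_cancel, Equiv.Perm.coe_one,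
    Set.image_id] at h'

lemma brokenLines_mul_left {G : Equiv.Perm (Fin n → F)} (hG : G ∈ AGammaL n F)
    (f : Equiv.Perm (Fin n → F)) :
    brokenLines F (G * f : Equiv.Perm (Fin n → F)) = brokenLines F f := by
  ext X
  simp only [brokenLines, Equiv.Perm.coe_mul, Set.image_comp]
  change _ ∧ ¬ _ ↔ _ ∧ ¬ _
  rw [isFlat_image_iff_of_mem_AGammaL hG]

lemma ncard_brokenLines_mul_right {G : Equiv.Perm (Fin n → F)} (hG : G ∈ AGammaL n F)
    (f : Equiv.Perm (Fin n → F)) :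
    (brokenLines F (f * G : Equiv.Perm (Fin n → F))).ncard = (brokenLines F f).ncard := by
  refine Set.ncard_congr (fun X _ => G '' X) ?_ ?_ ?_
  · rintro X ⟨h1, h2⟩
    refine ⟨(isFlat_image_iff_of_mem_AGammaL hG).2 h1, ?_⟩
    rwa [Equiv.Perm.coe_mul, Set.image_comp] at h2
  · intro X Y _ _ h
    exact G.injective.image_injective h
  · rintro Y ⟨h1, h2⟩
    obtain ⟨X, rfl⟩ : ∃ X, G '' X = Y := ⟨G ⁻¹' Y, Set.image_preimage_eq _ G.surjective⟩
    refine ⟨X, ⟨(isFlat_image_iff_of_mem_AGammaL hG).1 h1, ?_⟩, rfl⟩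
    rwa [Equiv.Perm.coe_mul, Set.image_comp]

/-- The semiaffine group is 2-transitive, so all transpositions are conjugate in it. -/
lemma exists_conj_swap [DecidableEq F] {s t s' t' : Fin n → F} (hst : s ≠ t) (hst' : s' ≠ t') :
    ∃ g ∈ AGammaL n F, Equiv.swap s t = g * Equiv.swap s' t' * g⁻¹ := by
  obtain ⟨A, hA⟩ := exists_linearEquiv_apply_eq (F := F) (sub_ne_zero.2 hst'.symm)
    (sub_ne_zero.2 hst.symm)
  let G : Equiv.Perm (Fin n → F) := A.toEquiv.trans (Equiv.addRight (s - A s'))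
  have hG : ∀ x, G x = A x + (s - A s') := fun _ => rfl
  refine ⟨G, ⟨RingEquiv.refl F, A.toAddEquiv, s - A s', fun α x => A.map_smul α x, hG⟩, ?_⟩
  have h1 : G s' = s := by rw [hG, add_sub_cancel]
  have h2 : G t' = t := by
    rw [map_sub, sub_eq_sub_iff_add_eq_add] at hA
    rw [hG, ← add_sub_assoc, hA, add_sub_cancel_right]
  rw [← Equiv.swap_apply_apply, h1, h2]

/-- A permutation that breaks at most as many lines as a transposition does is semiaffine or the
product of a semiaffine permutation and a transposition. -/
lemma exists_eq_mul_swap [Fintype F] [DecidableEq F] (hq : 2 < Fintype.card F) (hn : 3 ≤ n)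
    {f : Equiv.Perm (Fin n → F)} (hf : f ∉ AGammaL n F)
    (hB : (Fintype.card F - 1) * (brokenLines F f).ncard + 2 * Fintype.card F
      ≤ 2 * Fintype.card (Fin n → F)) :
    ∃ G ∈ AGammaL n F, ∃ s t, s ≠ t ∧ f = G * Equiv.swap s t := by
  have hcard : Fintype.card (Fin n → F) = Fintype.card F ^ n := by simp
  obtain ⟨m, rfl⟩ : ∃ m, n = m + 3 := ⟨n - 3, by omega⟩
  set q := Fintype.card F with hqdef
  have hq0 : 0 < q := by omega
  have hm1 : 1 ≤ q ^ m := Nat.one_le_pow _ _ hq0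
  have hN : Fintype.card (Fin (m + 3) → F) = q ^ (m + 1) * (q * q) := by rw [hcard]; ring
  have hN3 : 3 ≤ q ^ (m + 1) := by
    rw [pow_succ]
    nlinarith
  have hV : q < Fintype.card (Fin (m + 3) → F) := by
    rw [hN]
    nlinarith
  -- Avoiding multiples of 0 only asks that `ψ` be nonzero; the second application makes `φ`
  -- independent of `ψ`.
  obtain ⟨ψ, b, hψ, hψg⟩ := exists_clean_hyperplane hq hV f.injective hB 0
  have hψ0 : ψ ≠ 0 := by simpa using hψ 0
  obtain ⟨φ, a, hφψ, hφg⟩ := exists_clean_hyperplane hq hV f.injective hB ψ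
  obtain ⟨G, hG, hfG⟩ := exists_semiAffine_of_clean hq (by simp) f.injective
    hψ0 hφψ hφg hψg
  have hG' : G ∈ AGammaL (m + 3) F := hG
  set h : Equiv.Perm (Fin (m + 3) → F) := G⁻¹ * f with hh
  have hfGh : f = G * h := by rw [hh, mul_inv_cancel_left]
  have hfix : ∀ x, φ x = a ∨ ψ x = b → h x = x := by
    intro x hx
    rw [hh, Equiv.Perm.mul_apply, hfG x hx, ← Equiv.Perm.mul_apply, inv_mul_cancel,
      Equiv.Perm.one_apply]
  have hBh : (brokenLines F h).ncard = (brokenLines F f).ncard := by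
    rw [hh, brokenLines_mul_left ((AGammaL (m + 3) F).inv_mem hG')]
  have hsup := card_movedPoints_le_of_fixed hq h.injective hψ0 hφψ hfix hN
  have hmov := card_movedPoints_mul_le (F := F) hq h.injective
  have h1 : h ≠ 1 := by
    intro h1
    rw [h1, mul_one] at hfGh
    exact hf (hfGh ▸ hG')
  have h2 := Equiv.Perm.one_lt_card_support_of_ne_one h1
  rw [card_movedPoints_perm, hBh] at hsup hmov
  rw [← hqdef] at hmov
  -- Let `d` points move, `d ≥ 3`, and put `y = v - q`, `w = q - 1`. From `2 N - 1 ≥ 5` the first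
  -- estimate gives `5 d w ≤ 4 y`, so `d w < y`. The second reads `(d - 2) y ≤ d (d - 2) w`, that is
  -- `y ≤ d w`.
  have hd2 : h.support.card = 2 := by
    generalize h.support.card = d at *
    generalize (brokenLines F f).ncard = c at *
    generalize Fintype.card (Fin (m + 3) → F) = v at *
    generalize q ^ (m + 1) = N at *
    clear_value q
    by_contra hd
    obtain ⟨e, rfl⟩ : ∃ e, d = e + 3 := ⟨d - 3, by omega⟩
    obtain ⟨w, rfl⟩ : ∃ w, q = w + 1 := ⟨q - 1, by omega⟩
    obtain ⟨y, rfl⟩ : ∃ y, v = w + 1 + y := ⟨v - (w + 1), by omega⟩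
    have hsup' : (e + 3) * 5 ≤ 2 * c :=
      (Nat.mul_le_mul_left _ (by omega : 5 ≤ 2 * N - 1)).trans hsup
    simp only [Nat.add_sub_cancel] at hB hmov
    rw [show w + 1 + y - 1 = w + y by omega, show e + 3 - 1 = e + 2 by omega] at hmov
    have hc : w * c ≤ 2 * y := by linarith
    have h5 : (e + 3) * w < y := by
      have := Nat.mul_le_mul_left w hsup'
      have h6 : 5 * ((e + 3) * w) ≤ 4 * y := by nlinarith
      omega
    have h7 : (e + 3) * (w + y) ≤ 2 * y + (e + 3) * ((e + 2) * w) := by nlinarith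
    nlinarith
  obtain ⟨s, t, hst, hs⟩ := Equiv.Perm.card_support_eq_two.1 hd2
  exact ⟨G, hG', s, t, hst, by rw [← hs]; exact hfGh⟩

end SemiAffine

/-! ### The main theorem -/

theorem theorem8p4 {F : Type*} [Field F] [Fintype F] [DecidableEq F] (q n : ℕ)
    (hcard : Fintype.card F = q) (hq : 2 < q) (hn : 3 ≤ n)
    (f : Equiv.Perm (Fin n → F)) (hf : f ∉ AGammaL n F) :
    2 * (q : ℚ) * ((q : ℚ) ^ (n - 1) - 1) / ((q : ℚ) - 1) ≤ (coaffinity F 1 f : ℚ) ∧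
    ∀ τ : Equiv.Perm (Fin n → F), τ.IsSwap →
      ((coaffinity F 1 f : ℚ) = 2 * (q : ℚ) * ((q : ℚ) ^ (n - 1) - 1) / ((q : ℚ) - 1) ↔
        ∃ g ∈ AGammaL n F, ∃ h ∈ AGammaL n F, f = g * τ * h) := by
  subst hcard
  set q := Fintype.card F with hqdef
  have hco : coaffinity F 1 f = (brokenLines F f).ncard := rfl
  have hV : Fintype.card (Fin n → F) = q ^ n := by simp [hqdef]
  have hqn : q ≤ q ^ n := Nat.le_self_pow (by omega) q
  have hq1 : (0 : ℚ) < (q : ℚ) - 1 := by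
    have : (2 : ℚ) < q := by exact_mod_cast hq
    linarith
  have hnum : 2 * (q : ℚ) * ((q : ℚ) ^ (n - 1) - 1) = 2 * ((q : ℚ) ^ n - q) := by
    obtain ⟨k, rfl⟩ : ∃ k, n = k + 1 := ⟨n - 1, by omega⟩
    rw [Nat.add_sub_cancel, pow_succ]
    ring
  have hswap : ∀ s t : Fin n → F, s ≠ t →
      ((brokenLines F (Equiv.swap s t)).ncard : ℚ) * ((q : ℚ) - 1) = 2 * ((q : ℚ) ^ n - q) := by
    intro s t hst
    have := ncard_brokenLines_swap (F := F) hq hst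
    rw [hV, ← hqdef] at this
    have h := congrArg (Nat.cast : ℕ → ℚ) this
    push_cast [Nat.cast_sub hqn, Nat.cast_sub (show 1 ≤ q by omega)] at h
    exact h
  have hsmall : (coaffinity F 1 f : ℚ) * ((q : ℚ) - 1) ≤ 2 * ((q : ℚ) ^ n - q) →
      ∃ G ∈ AGammaL n F, ∃ s t, s ≠ t ∧ f = G * Equiv.swap s t := by
    intro h
    refine exists_eq_mul_swap hq hn hf ?_
    rw [← hco, hV, ← hqdef]
    have : (((q - 1) * coaffinity F 1 f + 2 * q : ℕ) : ℚ) ≤ ((2 * q ^ n : ℕ) : ℚ) := by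
      push_cast [Nat.cast_sub (show 1 ≤ q by omega)]
      linarith
    exact_mod_cast this
  rw [hnum]
  refine ⟨?_, ?_⟩
  · rw [div_le_iff₀ hq1]
    -- A permutation below the bound would be a semiaffine map times a transposition, and so would
    -- attain the bound exactly.
    by_contra! hlt
    obtain ⟨G, hG, s, t, hst, rfl⟩ := hsmall hlt.le
    rw [hco, brokenLines_mul_left hG, hswap s t hst] at hlt
    exact lt_irrefl _ hlt
  · rintro τ ⟨s', t', hst', rfl⟩
    rw [eq_div_iff hq1.ne']
    constructor
    · intro heq
      obtain ⟨G, hG, s, t, hst, rfl⟩ := hsmall heq.le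
      obtain ⟨g, hg, hconj⟩ := exists_conj_swap hst hst'
      exact ⟨G * g, (AGammaL n F).mul_mem hG hg, g⁻¹, (AGammaL n F).inv_mem hg, by
        rw [hconj]; group⟩
    · rintro ⟨g, hg, h, hh, rfl⟩
      rw [hco, ncard_brokenLines_mul_right hh, brokenLines_mul_left hg, hswap s' t' hst']
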